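/- Let $k\ge 1$ be an integer and let $S$ be a (connected) Riemann surface. A meromorphic connection $\nabla$ on the tangent bundle $TS$ has, in every holomorphic chart $(U_\alpha,z_\alpha)$, a local representation $\eta_\alpha$, the meromorphic $1$-form on $U_\alpha$ with $\nabla(\partial/\partial z_\alpha)=\eta_\alpha\otimes\partial/\partial z_\alpha$. Its poles and its residues $\mathrm{Res}_p\nabla$ are those of the forms $\eta_\alpha$, and $\nabla$ is Fuchsian if all its poles are simple. It has monodromy in a subgroup $G\subseteq\mathbb{C}^*$ if the complement of its poles has an atlas of charts $(U_\alpha,z_\alpha)$ in which $\nabla$ is represented by $\eta_\alpha\equiv 0$ and whose transition functions have the form $z_\beta=a_{\alpha\beta}z_\alpha+c_{\alpha\beta}$ on $U_\alpha\cap U_\beta$ with $a_{\alpha\beta}\in G$ and $c_{\alpha\beta}\in\mathbb{C}$. A geodesic of $\nabla$ is a smooth curve $\sigma$ on an interval, in the complement of the poles, with $\nabla_{\sigma'}\sigma'\equiv 0$. A meromorphic $k$-differential $q$ on $S$ is a meromorphic section of the $k$-th power of the canonical bundle, locally $q=q_\alpha\,dz_\alpha^k$. Its critical points are its zeros and poles.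 A geodesic of $q$ is a smooth curve on an interval, in the complement of the critical points, that is a geodesic of the flat metric $g$ given by $g^{1/2}=|q_\alpha|^{1/k}|dz_\alpha|$. We say that $\nabla$ and $q$ are adapted to each other if they have the same geodesics and if the poles of $\nabla$ are exactly the critical points of $q$. Let $\mathbb{Z}_k\subset\mathbb{C}^*$ be the group of $k$-th roots of unity. (1) Let $\nabla$ be a Fuchsian meromorphic connection on $S$ with monodromy in $\mathbb{Z}_k$ and all residues in $\frac1k\mathbb{Z}$. Then there is a meromorphic $k$-differential $q$ adapted to $\nabla$, and it is unique up to a non-zero constant: the meromorphic $k$-differentials adapted to $\nabla$ are exactly the $cq$ with $c\in\mathbb{C}^*$. (2) Conversely, let $q$ be a meromorphic $k$-differential on $S$ that is not identically zero. Then there is a unique meromorphic connection $\nabla$ on $S$ adapted to $q$. Moreover, $\nabla$ is Fuchsian, has monodromy in $\mathbb{Z}_k$, and all its residues lie in $\frac1k\mathbb{Z}$. -/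

import Mathlib

open scoped Manifold ContDiff Topology

noncomputable section

namespace MeroConn

/-- The holomorphic charts of a Riemann surface: the members of the maximal complex
analytic atlas. -/
abbrev HolChart (S : Type*) [TopologicalSpace S] [ChartedSpace ℂ S] :=
  {e : OpenPartialHomeomorph S ℂ // e ∈ IsManifold.maximalAtlas 𝓘(ℂ) ω S}

section Basic

variable {S : Type*} [TopologicalSpace S] [ChartedSpace ℂ S]

/-- The transition function `e' ∘ e⁻¹` between two charts: the coordinate `z'` of `e'` as a
function of the coordinate `z` of `e`. -/
def transition (e e' : HolChart S) : ℂ → ℂ := fun z => e'.1 (e.1.symm z)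

/-- The preferred chart at a point. -/
def chartOf [IsManifold 𝓘(ℂ) ω S] (p : S) : HolChart S :=
  ⟨chartAt ℂ p, IsManifold.chart_mem_maximalAtlas p⟩

/-- A smooth curve in `S` defined on a nondegenerate interval `I ⊆ ℝ` (open or not at either
end, bounded or not); only the restriction of `σ` to `I` matters. -/
structure IsSmoothCurve (I : Set ℝ) (σ : ℝ → S) : Prop where
  interval : I.OrdConnected
  nondegenerate : (interior I).Nonempty
  continuousOn : ContinuousOn σ I
  smooth : ∀ t ∈ I, ∀ e : HolChart S, σ t ∈ e.1.source →
    ContDiffWithinAt ℝ ∞ (fun s => e.1 (σ s)) I t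

/-- The velocity of a curve at time `t`, in the chart `e`. -/
def velocity (e : HolChart S) (I : Set ℝ) (σ : ℝ → S) (t : ℝ) : ℂ :=
  derivWithin (fun s => e.1 (σ s)) I t

/-- The second derivative of a curve at time `t`, in the chart `e`. -/
def secondDeriv (e : HolChart S) (I : Set ℝ) (σ : ℝ → S) (t : ℝ) : ℂ :=
  derivWithin (fun s => velocity e I σ s) I t

end Basic

/-- The residue at `x` of a function meromorphic at `x`: the value of
`(2πi)⁻¹ ∮ f` on small circles around `x`. -/
def residue (f : ℂ → ℂ) (x : ℂ) : ℂ :=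
  Filter.limUnder (𝓝[>] (0 : ℝ))
    (fun R : ℝ => (2 * (Real.pi : ℂ) * Complex.I)⁻¹ * ∮ z in C(x, R), f z)

/-- A meromorphic connection `∇` on the tangent bundle of a Riemann surface, given by its local
representations: in a chart `e` with coordinate `z` one has `∇(∂/∂z) = η ⊗ ∂/∂z` with the
meromorphic `1`-form `η = rep e dz`. Since `∂/∂z = τ' ∂/∂z'` for the transition function `τ`
from `z` to `z'`, the Leibniz rule amounts to `η = η' + dτ'/τ'` on the overlap.

Meromorphic functions are represented by functions in normal form (continuous except at poles,
with value `0` at poles), extended by `0` outside the domain of the coordinate, so that equality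
of connections is equality of structures. Identities between meromorphic functions are stated
on punctured neighbourhoods. -/
@[ext]
structure MeromorphicConnection (S : Type*) [TopologicalSpace S] [ChartedSpace ℂ S] where
  rep : HolChart S → ℂ → ℂ
  meromorphic : ∀ e : HolChart S, MeromorphicNFOn (rep e) e.1.target
  rep_eq_zero : ∀ (e : HolChart S) (z : ℂ), z ∉ e.1.target → rep e z = 0
  transform : ∀ (e e' : HolChart S) (p : S), p ∈ e.1.source → p ∈ e'.1.source →
    ∀ᶠ z in 𝓝[≠] (e.1 p),
      rep e z = rep e' (transition e e' z) * deriv (transition e e') z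
        + deriv (deriv (transition e e')) z / deriv (transition e e') z

/-- A meromorphic `k`-differential on a Riemann surface: in a chart `e` with coordinate `z` it is
`rep e dz ^ k` with a meromorphic function `rep e` (same conventions as for connections), and
`rep e = (dz' / dz) ^ k * rep e'` on the overlap of two charts. -/
@[ext]
structure KDifferential (k : ℕ) (S : Type*) [TopologicalSpace S] [ChartedSpace ℂ S] where
  rep : HolChart S → ℂ → ℂ
  meromorphic : ∀ e : HolChart S, MeromorphicNFOn (rep e) e.1.target
  rep_eq_zero : ∀ (e : HolChart S) (z : ℂ), z ∉ e.1.target → rep e z = 0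
  transform : ∀ (e e' : HolChart S) (p : S), p ∈ e.1.source → p ∈ e'.1.source →
    ∀ᶠ z in 𝓝[≠] (e.1 p),
      rep e z = deriv (transition e e') z ^ k * rep e' (transition e e' z)

section Notions

variable {S : Type*} [TopologicalSpace S] [ChartedSpace ℂ S] [IsManifold 𝓘(ℂ) ω S]

namespace MeromorphicConnection

variable (D : MeromorphicConnection S)

/-- The order at `p` of the local representation of `D` in the preferred chart at `p`
(for poles, it does not depend on the chart). -/
def order (p : S) : WithTop ℤ :=
  meromorphicOrderAt (D.rep (chartOf p)) ((chartOf p).1 p)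

/-- `p` is a pole of the connection. -/
def IsPole (p : S) : Prop := D.order p < 0

/-- All poles are Fuchsian, that is, simple. -/
def IsFuchsian : Prop := ∀ p : S, D.IsPole p → D.order p = -1

/-- The residue of the connection at `p` (it does not depend on the chart). -/
def residueAt (p : S) : ℂ := residue (D.rep (chartOf p)) ((chartOf p).1 p)

/-- All residues of the connection lie in `(1/k)ℤ`. -/
def HasResiduesIn (k : ℕ) : Prop :=
  ∀ p : S, ∃ m : ℤ, D.residueAt p = (m : ℂ) / (k : ℂ)

/-- The connection has monodromy in `G`: the complement of the poles has an atlas of charts in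
which the connection is represented by `0` and whose transition functions have the form
`z' = a z + c` with `a ∈ G`. -/
def HasMonodromyIn (G : Subgroup ℂˣ) : Prop :=
  ∃ A : Set (HolChart S),
    (∀ e ∈ A, ∀ p ∈ e.1.source, ¬ D.IsPole p) ∧
    (∀ p : S, ¬ D.IsPole p → ∃ e ∈ A, p ∈ e.1.source) ∧
    (∀ e ∈ A, ∀ z ∈ e.1.target, D.rep e z = 0) ∧
    (∀ e ∈ A, ∀ e' ∈ A, ∃ a ∈ G, ∃ c : ℂ,
      ∀ p ∈ e.1.source ∩ e'.1.source, e'.1 p = (a : ℂ) * e.1 p + c)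

/-- A geodesic of the connection: a smooth curve `σ` on an interval, in the complement of the
poles, with `∇_{σ'} σ' = 0`, that is, `z'' + f(z) z'^2 = 0` where `z` is the expression of `σ`
in a chart and `f dz` is the local representation of the connection. -/
def IsGeodesic (I : Set ℝ) (σ : ℝ → S) : Prop :=
  IsSmoothCurve I σ ∧ (∀ t ∈ I, ¬ D.IsPole (σ t)) ∧
    ∀ t ∈ I, ∀ e : HolChart S, σ t ∈ e.1.source →
      secondDeriv e I σ t + D.rep e (e.1 (σ t)) * velocity e I σ t ^ 2 = 0

end MeromorphicConnection

/-- The geodesic equation at time `t` of the conformal metric given by `g^(1/2) = l |dz|` in the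
chart `e`: the acceleration `z'' + 2 du(z') z' - |z'|^2 grad u` of the curve with respect to the
Levi-Civita connection of `g = exp(2u) |dz|^2`, `u = log l`, vanishes. -/
def ConformalGeodesicEq (e : HolChart S) (l : ℂ → ℝ) (I : Set ℝ) (σ : ℝ → S) (t : ℝ) : Prop :=
  secondDeriv e I σ t
    + (2 * fderiv ℝ (fun w => Real.log (l w)) (e.1 (σ t)) (velocity e I σ t)) • velocity e I σ t
    - (‖velocity e I σ t‖ ^ 2) • gradient (fun w => Real.log (l w)) (e.1 (σ t)) = 0

namespace KDifferential

variable {k : ℕ} (q : KDifferential k S)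

/-- `q` is not the zero differential. -/
def IsNonzero : Prop := ∃ (e : HolChart S) (z : ℂ), q.rep e z ≠ 0

/-- The order of `q` at `p`, read in the preferred chart (it does not depend on the chart):
positive at zeros, negative at poles, `⊤` where `q` vanishes identically. -/
def order (p : S) : WithTop ℤ :=
  meromorphicOrderAt (q.rep (chartOf p)) ((chartOf p).1 p)

/-- The critical points of `q`: its zeros and its poles. -/
def IsCritical (p : S) : Prop := q.order p ≠ 0

/-- The length element of the metric defined by `q`, in the chart `e`:
`g^(1/2) = |q|^(1/k) |dz|`. -/
def lengthElement (e : HolChart S) (z : ℂ) : ℝ := ‖q.rep e z‖ ^ (1 / (k : ℝ))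

/-- A geodesic of `q`: a smooth curve on an interval, in the complement of the critical points,
which is a geodesic of the metric `|q|^(2/k) |dz|^2`. -/
def IsGeodesic (I : Set ℝ) (σ : ℝ → S) : Prop :=
  IsSmoothCurve I σ ∧ (∀ t ∈ I, ¬ q.IsCritical (σ t)) ∧
    ∀ t ∈ I, ∀ e : HolChart S, σ t ∈ e.1.source →
      ConformalGeodesicEq e (q.lengthElement e) I σ t

end KDifferential

/-- A meromorphic connection and a meromorphic `k`-differential are adapted to each other if they
have the same critical points (the poles, for the connection) and the same geodesics. -/
def Adapted {k : ℕ} (D : MeromorphicConnection S) (q : KDifferential k S) : Prop :=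
  (∀ p : S, D.IsPole p ↔ q.IsCritical p) ∧
    ∀ (I : Set ℝ) (σ : ℝ → S), D.IsGeodesic I σ ↔ q.IsGeodesic I σ

end Notions

end MeroConn

end

noncomputable section

namespace MeroConn
open Filter

/-! In a coordinate, the geodesic equation of the metric `|q|^(2/k) |dz|^2` is `z'' + (q'/(kq)) z'^2
= 0`: the gradient of `(1/k) log|q|` is the conjugate of `q'/(kq)`, and the real terms recombine
into a holomorphic multiple of `z'^2`. The geodesic equation of the connection is `z'' + η z'^2 =
0`. Every non-pole carries a geodesic of nonzero velocity, a straight line in a flat coordinate, so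
equality of geodesics amounts to `η = q'/(kq)` off the critical points. This is `adapted_iff`; the
rest is the study of this equation.

Given `q`, the formula defines a connection, since taking the logarithmic derivative of `q = τ'^k (q
∘ τ)` produces `k τ''/τ'`. At a point of order `n ≠ 0` it has a simple pole of residue `n/k`.
Coordinates with `q = dz^k` are flat and differ locally by `z ↦ az + c` with `a^k = 1`;
`exists_affine_on_disc` makes the affine map uniform on overlaps of suitable discs.

Given the connection, the forms `dw^k` in flat coordinates `w` glue, because `a^k = 1` for the
linear parts of the transitions. Near a pole the resulting function solves `f' = kηf`, where `kη`
has a simple pole with nonzero integer residue `m`, hence `f = (z - x)^m u` with `u` a holomorphic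
unit (`eventually_eq_zpow_mul_of_hasDerivAt`). Two adapted differentials have the same logarithmic
derivative, so their quotient is locally constant, and constant by connectedness. -/

/-! ### One-variable complex analysis -/

lemma _root_.AnalyticAt.exists_primitive {g : ℂ → ℂ} {x : ℂ} (hg : AnalyticAt ℂ g x) :
    ∃ G : ℂ → ℂ, AnalyticAt ℂ G x ∧ ∀ᶠ z in 𝓝 x, HasDerivAt G (g z) z := by
  obtain ⟨r, hr, h⟩ := Metric.eventually_nhds_iff_ball.1 hg.eventually_analyticAt
  obtain ⟨G, hG⟩ : Complex.IsExactOn g (Metric.ball x r) :=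
    DifferentiableOn.isExactOn_ball fun z hz => (h z hz).differentiableAt.differentiableWithinAt
  have hev : ∀ᶠ z in 𝓝 x, HasDerivAt G (g z) z :=
    Metric.eventually_nhds_iff_ball.2 ⟨r, hr, hG⟩
  exact ⟨G, Complex.analyticAt_iff_eventually_differentiableAt.2
    (hev.mono fun z hz => hz.differentiableAt), hev⟩

/-- A punctured disc is the image of a left half-plane under a translated exponential. -/
lemma isPreconnected_ball_diff_singleton (x : ℂ) {r : ℝ} (hr : 0 < r) :
    IsPreconnected (Metric.ball x r \ {x}) := by
  have : Metric.ball x r \ {x} = (fun w => x + Complex.exp w) '' {w : ℂ | w.re < Real.log r} := by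
    ext z
    simp only [Set.mem_sdiff, Metric.mem_ball, Set.mem_singleton_iff, Set.mem_image,
      Set.mem_ofPred_eq, dist_eq_norm]
    constructor
    · rintro ⟨h1, h2⟩
      have h3 : z - x ≠ 0 := sub_ne_zero.2 h2
      refine ⟨Complex.log (z - x), ?_, by rw [Complex.exp_log h3]; ring⟩
      rw [Complex.log_re]
      exact Real.log_lt_log (norm_pos_iff.2 h3) h1
    · rintro ⟨w, hw, rfl⟩
      refine ⟨?_, by simp [Complex.exp_ne_zero]⟩
      rw [add_sub_cancel_left, Complex.norm_exp]
      exact (Real.lt_log_iff_exp_lt hr).1 hw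
  rw [this]
  refine (convex_halfSpace_re_lt _).isPreconnected.image _ ?_
  fun_prop

lemma exists_eventually_eq_const_of_hasDerivAt_zero {f : ℂ → ℂ} {x : ℂ}
    (h : ∀ᶠ z in 𝓝[≠] x, HasDerivAt f 0 z) : ∃ c, ∀ᶠ z in 𝓝[≠] x, f z = c := by
  rw [eventually_nhdsWithin_iff] at h
  obtain ⟨r, hr, h⟩ := Metric.eventually_nhds_iff_ball.1 h
  obtain ⟨c, hc⟩ := (Metric.isOpen_ball.sdiff isClosed_singleton
      : IsOpen (Metric.ball x r \ {x})).exists_is_const_of_fderiv_eq_zero (𝕜 := ℂ) (f := f)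
    (isPreconnected_ball_diff_singleton x hr)
    (fun z hz => (h z hz.1 hz.2).differentiableAt.differentiableWithinAt)
    (fun z hz => by simpa using (h z hz.1 hz.2).hasFDerivAt.fderiv)
  refine ⟨c, ?_⟩
  rw [eventually_nhdsWithin_iff]
  exact Metric.eventually_nhds_iff_ball.2 ⟨r, hr, fun z hz hzx => hc z ⟨hz, hzx⟩⟩

lemma hasDerivAt_sub_zpow {x z : ℂ} (n : ℤ) (h : z - x ≠ 0) :
    HasDerivAt (fun z : ℂ => (z - x) ^ n) (n * (z - x) ^ (n - 1)) z :=
  (hasDerivAt_zpow n (z - x) (Or.inl h)).comp_sub_const z x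

/-- Solutions of a linear equation with a Fuchsian singularity whose exponent is an integer. -/
lemma eventually_eq_zpow_mul_of_hasDerivAt {f g : ℂ → ℂ} {x : ℂ} {n : ℤ}
    (hg : AnalyticAt ℂ g x) (hn : g x = n)
    (h : ∀ᶠ z in 𝓝[≠] x, f z ≠ 0 ∧ HasDerivAt f (f z * ((z - x)⁻¹ * g z)) z) :
    ∃ u : ℂ → ℂ, AnalyticAt ℂ u x ∧ u x ≠ 0 ∧ ∀ᶠ z in 𝓝[≠] x, f z = (z - x) ^ n * u z := by
  obtain ⟨u₀, hu₀, hgu⟩ : ∃ u₀ : ℂ → ℂ, AnalyticAt ℂ u₀ x ∧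
      ∀ᶠ z in 𝓝 x, g z = n + (z - x) * u₀ z := by
    obtain ⟨p, hp⟩ := hg
    refine ⟨dslope g x, hp.has_fpower_series_dslope_fslope.analyticAt, Eventually.of_forall ?_⟩
    intro z
    have := sub_smul_dslope g x z
    rw [smul_eq_mul] at this
    rw [this, hn]; ring
  obtain ⟨H, hH, hH'⟩ := hu₀.exists_primitive
  -- Integrating factor: with `H` a primitive of the regular part of `g z / (z - x)`, the product `f
  -- (z - x)^(-n) exp(-H)` has derivative zero. Integrality of `n` makes it single-valued.
  have key : ∀ᶠ z in 𝓝[≠] x,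
      HasDerivAt (fun z => f z * ((z - x) ^ (-n) * Complex.exp (-H z))) 0 z := by
    filter_upwards [h, hgu.filter_mono nhdsWithin_le_nhds, hH'.filter_mono nhdsWithin_le_nhds,
      self_mem_nhdsWithin] with z ⟨_, hz⟩ hgz hHz hzx
    have hzx' : z - x ≠ 0 := sub_ne_zero.2 hzx
    have h1 := hasDerivAt_sub_zpow (-n) hzx'
    refine (hz.mul (h1.mul hHz.neg.cexp)).congr_deriv ?_
    simp only [Pi.mul_apply, Pi.neg_apply]
    rw [hgz, zpow_sub_one₀ hzx']
    push_cast
    field_simp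
    ring
  obtain ⟨c, hc⟩ := exists_eventually_eq_const_of_hasDerivAt_zero key
  have hfc : ∀ᶠ z in 𝓝[≠] x, c ≠ 0 ∧ f z = (z - x) ^ n * (c * Complex.exp (H z)) := by
    filter_upwards [hc, h, self_mem_nhdsWithin] with z hz ⟨h0, _⟩ hzx
    have hzx' : z - x ≠ 0 := sub_ne_zero.2 hzx
    have h3 : (z - x) ^ n ≠ 0 := zpow_ne_zero _ hzx'
    have h4 := Complex.exp_ne_zero (H z)
    rw [Complex.exp_neg, zpow_neg] at hz
    constructor
    · rw [← hz]
      positivity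
    · rw [← hz]; field_simp
  refine ⟨fun z => c * Complex.exp (H z), by fun_prop, ?_, hfc.mono fun z hz => hz.2⟩
  obtain ⟨z, hz⟩ := hfc.exists
  exact mul_ne_zero hz.1 (Complex.exp_ne_zero _)

lemma exists_logDeriv_eq_of_meromorphicOrderAt_eq {f : ℂ → ℂ} {x : ℂ} {n : ℤ}
    (hf : MeromorphicAt f x) (hn : meromorphicOrderAt f x = n) :
    ∃ g : ℂ → ℂ, AnalyticAt ℂ g x ∧ g x = n ∧
      ∀ᶠ z in 𝓝[≠] x, logDeriv f z = (z - x)⁻¹ * g z := by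
  obtain ⟨u, hu, hux, hfu⟩ := (meromorphicOrderAt_eq_int_iff hf).1 hn
  have hfu' : f =ᶠ[𝓝[≠] x] fun z => (z - x) ^ n * u z := hfu
  refine ⟨fun z => n + (z - x) * (deriv u z / u z), ?_, by simp, ?_⟩
  · have := hu.deriv.div hu hux
    fun_prop
  · filter_upwards [logDeriv_congr_nhdsNE hfu', hu.eventually_analyticAt.filter_mono
      nhdsWithin_le_nhds, (hu.continuousAt.eventually_ne hux).filter_mono nhdsWithin_le_nhds,
      self_mem_nhdsWithin] with z hz huz huz0 hzx
    have hzx' : z - x ≠ 0 := sub_ne_zero.2 hzx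
    have h1 := hasDerivAt_sub_zpow n hzx'
    have h2 := (h1.mul huz.differentiableAt.hasDerivAt).deriv
    have h3 : (z - x) ^ n ≠ 0 := zpow_ne_zero _ hzx'
    rw [hz, logDeriv_apply]
    erw [h2]
    rw [zpow_sub_one₀ hzx']
    field_simp

/-- By Cauchy's formula the normalised circle integrals are constant for small radii. -/
lemma residue_eq_of_eventually_eq {f g : ℂ → ℂ} {x : ℂ} (hg : AnalyticAt ℂ g x)
    (h : ∀ᶠ z in 𝓝[≠] x, f z = (z - x)⁻¹ * g z) : residue f x = g x := by
  apply Tendsto.limUnder_eq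
  refine tendsto_const_nhds.congr' ?_
  rw [eventually_nhdsWithin_iff] at h
  obtain ⟨r, hr, h⟩ := Metric.eventually_nhds_iff_ball.1 (h.and hg.eventually_analyticAt)
  filter_upwards [Ioo_mem_nhdsGT hr] with R ⟨hR0, hRr⟩
  have h1 : (∮ z in C(x, R), f z) = ∮ z in C(x, R), (z - x)⁻¹ • g z := by
    refine circleIntegral.integral_congr hR0.le fun z hz => ?_
    have hz' : dist z x = R := hz
    refine (h z (by rw [Metric.mem_ball, hz']; exact hRr)).1 ?_
    rintro rfl
    simp at hz'
    linarith
  have h2 : DiffContOnCl ℂ g (Metric.ball x R) := by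
    apply DifferentiableOn.diffContOnCl
    rw [closure_ball _ hR0.ne']
    exact fun z hz => (h z (lt_of_le_of_lt hz hRr)).2.differentiableAt.differentiableWithinAt
  rw [h1, h2.circleIntegral_sub_inv_smul (Metric.mem_ball_self hR0), smul_eq_mul]
  have : (2 * (Real.pi : ℂ) * Complex.I) ≠ 0 := by simp [Real.pi_ne_zero]
  field_simp

/-- Up to a constant, `log‖q‖` is locally the real part of the holomorphic function `log (q / q x)`,
and the gradient of `Re F` is the conjugate of `F'`. Dividing by `q x` keeps the logarithm near `1`,
away from its cut. -/
lemma hasFDerivAt_log_norm_rpow {q : ℂ → ℂ} {q' x : ℂ} (hq : HasDerivAt q q' x) (h0 : q x ≠ 0)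
    (a : ℝ) :
    HasFDerivAt (fun w => Real.log (‖q w‖ ^ a))
      (InnerProductSpace.toDual ℝ ℂ (starRingEnd ℂ (a * (q' / q x)))) x := by
  have h1 : HasDerivAt (fun w => Complex.log (q w / q x)) (q' / q x) x := by
    have := (hq.div_const (q x)).clog (by rw [div_self h0]; exact Complex.one_mem_slitPlane)
    simpa [div_self h0] using this
  have h2 := ((Complex.reCLM.hasFDerivAt.comp x
    (h1.hasFDerivAt.restrictScalars ℝ)).add_const (Real.log ‖q x‖)).const_mul a
  refine (h2.congr_fderiv ?_).congr_of_eventuallyEq ?_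
  · ext v
    simp [Complex.inner]
    ring
  · filter_upwards [hq.continuousAt.eventually_ne h0] with w hw
    rw [Real.log_rpow (norm_pos_iff.2 hw)]
    simp [Complex.log_re, Real.log_div (norm_ne_zero_iff.2 hw) (norm_ne_zero_iff.2 h0)]

/-- The local inverse of an analytic function, with a ball as target. -/
lemma exists_openPartialHomeomorph_ball {G : ℂ → ℂ} {x : ℂ} (hG : AnalyticAt ℂ G x)
    (hG' : deriv G x ≠ 0) {U : Set ℂ} (hU : U ∈ 𝓝 x) :
    ∃ (φ : OpenPartialHomeomorph ℂ ℂ) (r : ℝ), 0 < r ∧ x ∈ φ.source ∧ φ.source ⊆ U ∧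
      φ.target = Metric.ball (G x) r ∧ (∀ z, φ z = G z) ∧ φ ∈ contDiffGroupoid ω 𝓘(ℂ) := by
  set i : ℂ ≃L[ℂ] ℂ := .unitsEquivAut ℂ (.mk0 _ hG')
  have hd : HasStrictFDerivAt G i.toContinuousLinearMap x := hG.hasStrictDerivAt
  set R : OpenPartialHomeomorph ℂ ℂ := hd.toOpenPartialHomeomorph _
  have hR : ∀ z, R z = G z := fun z => rfl
  have hx : x ∈ R.source := HasStrictFDerivAt.mem_toOpenPartialHomeomorph_source _
  have hinv : AnalyticAt ℂ R.symm (G x) := by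
    refine (R.hasFPowerSeriesAt_symm hx hG.hasFPowerSeriesAt (i := i) ?_).analyticAt
    ext
    simp [i]
  have hV : ∀ᶠ z in 𝓝 x, z ∈ U ∧ AnalyticAt ℂ G z :=
    (show ∀ᶠ z in 𝓝 x, z ∈ U from hU).and hG.eventually_analyticAt
  have hs : R.symm (G x) = x := R.left_inv hx
  have hW : ∀ᶠ w in 𝓝 (G x), w ∈ R.target ∧ (R.symm w ∈ U ∧ AnalyticAt ℂ G (R.symm w)) ∧
      AnalyticAt ℂ R.symm w := by
    refine Eventually.and (R.open_target.mem_nhds (R.map_source hx)) (Eventually.and ?_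
      hinv.eventually_analyticAt)
    have := hinv.continuousAt
    rw [ContinuousAt, hs] at this
    exact this.eventually hV
  obtain ⟨r, hr, h⟩ := Metric.eventually_nhds_iff_ball.1 hW
  -- Restricting the inverse, rather than the map itself, makes the target exactly a ball.
  set φ := (R.symm.restr (Metric.ball (G x) r)).symm
  have hφt : φ.target = Metric.ball (G x) r := by
    simp only [φ, OpenPartialHomeomorph.symm_target, OpenPartialHomeomorph.restr_source,
      OpenPartialHomeomorph.symm_source, Metric.isOpen_ball.interior_eq]
    exact Set.inter_eq_right.2 fun w hw => (h w hw).1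
  have hφs : ∀ z, z ∈ φ.source ↔ z ∈ R.source ∧ G z ∈ Metric.ball (G x) r := by
    intro z
    simp [φ, Metric.isOpen_ball.interior_eq, ← hR]
  have hφG : ∀ z, φ z = G z := fun z => rfl
  refine ⟨φ, r, hr, (hφs x).2 ⟨hx, Metric.mem_ball_self hr⟩, ?_, hφt, hφG, ?_⟩
  · intro z hz
    have := (h _ ((hφs z).1 hz).2).2.1.1
    rwa [← hR, R.left_inv ((hφs z).1 hz).1] at this
  · rw [contDiffGroupoid, mem_groupoid_of_pregroupoid]
    simp only [contDiffPregroupoid, modelWithCornersSelf_coe, modelWithCornersSelf_coe_symm,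
      Function.id_comp, Function.comp_id, Set.preimage_id, Set.range_id, Set.inter_univ]
    constructor
    · intro z hz
      have := (h _ ((hφs z).1 hz).2).2.1.2
      rw [← hR, R.left_inv ((hφs z).1 hz).1] at this
      exact this.contDiffAt.contDiffWithinAt
    · intro w hw
      rw [hφt] at hw
      exact (h w hw).2.2.contDiffAt.contDiffWithinAt

/-! ### Charts and transition functions -/

section Charts

variable {S : Type*} [TopologicalSpace S] [ChartedSpace ℂ S]

lemma transition_apply {e : HolChart S} (e' : HolChart S) {p : S} (h : p ∈ e.1.source) :
    transition e e' (e.1 p) = e'.1 p := by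
  rw [transition, e.1.left_inv h]

lemma analyticAt_transition {e e' : HolChart S} {p : S} (h : p ∈ e.1.source)
    (h' : p ∈ e'.1.source) : AnalyticAt ℂ (transition e e') (e.1 p) := by
  have hc : e.1.symm.trans e'.1 ∈ contDiffGroupoid ω 𝓘(ℂ) :=
    StructureGroupoid.compatible_of_mem_maximalAtlas e.2 e'.2
  rw [contDiffGroupoid, mem_groupoid_of_pregroupoid] at hc
  have h1 := hc.1
  simp only [contDiffPregroupoid, modelWithCornersSelf_coe, modelWithCornersSelf_coe_symm,
    Function.id_comp, Function.comp_id, Set.preimage_id, Set.range_id, Set.inter_univ] at h1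
  have hmem : e.1 p ∈ (e.1.symm.trans e'.1).source := by
    simp [h, h']
  exact (h1.contDiffAt ((e.1.symm.trans e'.1).open_source.mem_nhds hmem)).analyticAt

lemma eventually_mem_target {e : HolChart S} {p : S} (h : p ∈ e.1.source) :
    ∀ᶠ z in 𝓝 (e.1 p), z ∈ e.1.target :=
  e.1.open_target.mem_nhds (e.1.map_source h)

lemma eventually_symm_mem_source {e e' : HolChart S} {p : S} (h : p ∈ e.1.source)
    (h' : p ∈ e'.1.source) :
    ∀ᶠ z in 𝓝 (e.1 p), z ∈ e.1.target ∧ e.1.symm z ∈ e'.1.source := by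
  refine (eventually_mem_target h).and ?_
  have := e.1.symm.continuousAt (e.1.map_source h)
  rw [ContinuousAt, e.1.left_inv h] at this
  exact this.eventually (e'.1.open_source.mem_nhds h')

lemma transition_transition {e e' e'' : HolChart S} {p : S} (h : p ∈ e.1.source)
    (h' : p ∈ e'.1.source) :
    ∀ᶠ z in 𝓝 (e.1 p), transition e' e'' (transition e e' z) = transition e e'' z := by
  filter_upwards [eventually_symm_mem_source h h'] with z hz
  simp only [transition]
  rw [e'.1.left_inv hz.2]

lemma transition_self_eventuallyEq {e : HolChart S} {p : S} (h : p ∈ e.1.source) :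
    transition e e =ᶠ[𝓝 (e.1 p)] id := by
  filter_upwards [eventually_mem_target h] with z hz
  exact e.1.right_inv hz

lemma deriv_transition_mul {e e' : HolChart S} (e'' : HolChart S) {p : S} (h : p ∈ e.1.source)
    (h' : p ∈ e'.1.source) (h'' : p ∈ e''.1.source) :
    deriv (transition e' e'') (e'.1 p) * deriv (transition e e') (e.1 p)
      = deriv (transition e e'') (e.1 p) := by
  have h1 := analyticAt_transition h h'
  have h2 := analyticAt_transition h' h''
  rw [← transition_apply e' h] at h2 ⊢
  rw [← deriv_comp _ h2.differentiableAt h1.differentiableAt]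
  exact EventuallyEq.deriv_eq (transition_transition h h')

lemma deriv_transition_self {e : HolChart S} {p : S} (h : p ∈ e.1.source) :
    deriv (transition e e) (e.1 p) = 1 := by
  rw [(transition_self_eventuallyEq h).deriv_eq, deriv_id]

lemma deriv_transition_ne_zero {e e' : HolChart S} {p : S} (h : p ∈ e.1.source)
    (h' : p ∈ e'.1.source) : deriv (transition e e') (e.1 p) ≠ 0 := by
  have := deriv_transition_mul e h h' h
  rw [deriv_transition_self h] at this
  exact right_ne_zero_of_mul_eq_one this

/-- New charts obtained from locally biholomorphic functions of a coordinate. -/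
lemma exists_chart_comp {e : HolChart S} {p : S} (h : p ∈ e.1.source) {G : ℂ → ℂ}
    (hG : AnalyticAt ℂ G (e.1 p)) (hG' : deriv G (e.1 p) ≠ 0) {U : Set ℂ} (hU : U ∈ 𝓝 (e.1 p)) :
    ∃ (f : HolChart S) (r : ℝ), 0 < r ∧ p ∈ f.1.source ∧ f.1.target = Metric.ball (f.1 p) r ∧
      ∀ x ∈ f.1.source, x ∈ e.1.source ∧ e.1 x ∈ U ∧ transition e f =ᶠ[𝓝 (e.1 x)] G := by
  obtain ⟨φ, r, hr, hφs, hφU, hφt, hφ, hφg⟩ := exists_openPartialHomeomorph_ball hG hG'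
    (Filter.inter_mem hU (e.1.open_target.mem_nhds (e.1.map_source h)))
  have hmem : e.1.trans φ ∈ IsManifold.maximalAtlas 𝓘(ℂ) ω S := fun e' he' => by
    have h1 := e.2 e' he'
    refine ⟨?_, ?_⟩
    · rw [OpenPartialHomeomorph.trans_symm_eq_symm_trans_symm, OpenPartialHomeomorph.trans_assoc]
      exact (contDiffGroupoid ω 𝓘(ℂ)).trans ((contDiffGroupoid ω 𝓘(ℂ)).symm hφg) h1.1
    · rw [← OpenPartialHomeomorph.trans_assoc]
      exact (contDiffGroupoid ω 𝓘(ℂ)).trans h1.2 hφg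
  refine ⟨⟨e.1.trans φ, hmem⟩, r, hr, ⟨h, hφs⟩, ?_, ?_⟩
  · have : (e.1.trans φ) p = G (e.1 p) := hφ _
    simp only [this, OpenPartialHomeomorph.trans_target]
    rw [← hφt]
    exact Set.inter_eq_left.2 fun w hw => (hφU (φ.map_target hw)).2
  · rintro x ⟨hx, hx'⟩
    refine ⟨hx, (hφU hx').1, ?_⟩
    filter_upwards [eventually_mem_target hx] with z hz
    simp only [transition, OpenPartialHomeomorph.coe_trans, Function.comp_apply]
    rw [e.1.right_inv hz, hφ]

/-- The restriction of a chart to the part with coordinate in a given open set. -/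
def restrictTarget (e : HolChart S) {U : Set ℂ} (hU : IsOpen U) : HolChart S :=
  ⟨e.1.restr (e.1.source ∩ e.1 ⁻¹' U), restr_mem_maximalAtlas (contDiffGroupoid ω 𝓘(ℂ)) e.2
    (e.1.isOpen_inter_preimage hU)⟩

lemma mem_restrictTarget_source {e : HolChart S} {U : Set ℂ} (hU : IsOpen U) {p : S} :
    p ∈ (restrictTarget e hU).1.source ↔ p ∈ e.1.source ∧ e.1 p ∈ U := by
  simp only [restrictTarget, OpenPartialHomeomorph.restr_source,
    (e.1.isOpen_inter_preimage hU).interior_eq]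
  simp

lemma restrictTarget_apply {e : HolChart S} {U : Set ℂ} (hU : IsOpen U) (p : S) :
    (restrictTarget e hU).1 p = e.1 p := rfl

end Charts

/-! ### Local representations and flat coordinates -/

section Reps

variable {S : Type*} [TopologicalSpace S] [ChartedSpace ℂ S] [IsManifold 𝓘(ℂ) ω S]

lemma mem_chartOf_source (p : S) : p ∈ (chartOf p).1.source := mem_chart_source ℂ p

namespace KDifferential

variable {k : ℕ} (q : KDifferential k S)

-- Both sides are in normal form, so agreement on a punctured neighbourhood extends to the centre,
-- even at a critical point.
omit [IsManifold 𝓘(ℂ) ω S] in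
lemma eventually_rep_eq {e e' : HolChart S} {p : S} (h : p ∈ e.1.source) (h' : p ∈ e'.1.source) :
    ∀ᶠ z in 𝓝 (e.1 p),
      q.rep e z = deriv (transition e e') z ^ k * q.rep e' (transition e e' z) := by
  have ha := analyticAt_transition h h'
  have hd := deriv_transition_ne_zero h h'
  have hnf : MeromorphicNFAt (q.rep e' ∘ transition e e') (e.1 p) := by
    rw [meromorphicNFAt_comp_iff_of_deriv_ne_zero ha hd, transition_apply e' h]
    exact q.meromorphic e' (e'.1.map_source h')
  have hnf' : MeromorphicNFAt
      ((fun z => deriv (transition e e') z ^ k) * (q.rep e' ∘ transition e e')) (e.1 p) :=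
    (meromorphicNFAt_mul_iff_right (ha.deriv.pow k) (pow_ne_zero k hd)).2 hnf
  exact ((q.meromorphic e (e.1.map_source h)).eventuallyEq_nhdsNE_iff_eventuallyEq_nhds hnf').1
    (q.transform e e' p h h')

omit [IsManifold 𝓘(ℂ) ω S] in
lemma rep_eq {e e' : HolChart S} {p : S} (h : p ∈ e.1.source) (h' : p ∈ e'.1.source) :
    q.rep e (e.1 p) = deriv (transition e e') (e.1 p) ^ k * q.rep e' (e'.1 p) := by
  have := (q.eventually_rep_eq h h').self_of_nhds
  rwa [transition_apply e' h] at this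

lemma order_eq {e : HolChart S} {p : S} (h : p ∈ e.1.source) :
    q.order p = meromorphicOrderAt (q.rep e) (e.1 p) := by
  have h' := mem_chartOf_source p
  have ha := analyticAt_transition h' h
  have hd := deriv_transition_ne_zero h' h
  rw [order, meromorphicOrderAt_congr (q.transform _ e p h' h), ← transition_apply e h',
    ← meromorphicOrderAt_comp_of_deriv_ne_zero ha hd]
  exact meromorphicOrderAt_mul_of_ne_zero (ha.deriv.pow k) (pow_ne_zero k hd)

/-- A normal form takes the value `0` at its poles as well as at its zeros, so one value detects
both. -/
lemma not_isCritical_iff {e : HolChart S} {p : S} (h : p ∈ e.1.source) :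
    ¬ q.IsCritical p ↔ q.rep e (e.1 p) ≠ 0 := by
  rw [IsCritical, not_not, q.order_eq h,
    (q.meromorphic e (e.1.map_source h)).meromorphicOrderAt_eq_zero_iff]

lemma not_isCritical_symm_iff {e : HolChart S} {z : ℂ} (h : z ∈ e.1.target) :
    ¬ q.IsCritical (e.1.symm z) ↔ q.rep e z ≠ 0 := by
  rw [q.not_isCritical_iff (e.1.map_target h), e.1.right_inv h]

variable {q} in
lemma analyticAt_rep {e : HolChart S} {p : S} (h : p ∈ e.1.source) (hp : ¬ q.IsCritical p) :
    AnalyticAt ℂ (q.rep e) (e.1 p) := by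
  rw [IsCritical, not_not, q.order_eq h] at hp
  exact (q.meromorphic e (e.1.map_source h)).meromorphicOrderAt_nonneg_iff_analyticAt.1 hp.ge

end KDifferential

namespace MeromorphicConnection

variable (D : MeromorphicConnection S)

omit [IsManifold 𝓘(ℂ) ω S] in
lemma analyticAt_transform {e e' : HolChart S} {p : S} (h : p ∈ e.1.source)
    (h' : p ∈ e'.1.source) (ha : AnalyticAt ℂ (D.rep e') (e'.1 p)) :
    AnalyticAt ℂ (fun z => D.rep e' (transition e e' z) * deriv (transition e e') z
        + deriv (deriv (transition e e')) z / deriv (transition e e') z) (e.1 p) := by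
  have ht := analyticAt_transition h h'
  have hd := deriv_transition_ne_zero h h'
  rw [← transition_apply e' h] at ha
  exact ((ha.comp ht).mul ht.deriv).add (ht.deriv.deriv.div ht.deriv hd)

omit [IsManifold 𝓘(ℂ) ω S] in
lemma analyticAt_rep_of_analyticAt {e e' : HolChart S} {p : S} (h : p ∈ e.1.source)
    (h' : p ∈ e'.1.source) (ha : AnalyticAt ℂ (D.rep e') (e'.1 p)) :
    AnalyticAt ℂ (D.rep e) (e.1 p) := by
  rw [← (D.meromorphic e (e.1.map_source h)).meromorphicOrderAt_nonneg_iff_analyticAt,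
    meromorphicOrderAt_congr (D.transform e e' p h h')]
  exact (D.analyticAt_transform h h' ha).meromorphicOrderAt_nonneg

lemma not_isPole_iff {e : HolChart S} {p : S} (h : p ∈ e.1.source) :
    ¬ D.IsPole p ↔ AnalyticAt ℂ (D.rep e) (e.1 p) := by
  have h' := mem_chartOf_source p
  rw [IsPole, not_lt, order, (D.meromorphic (chartOf p)
    ((chartOf p).1.map_source h')).meromorphicOrderAt_nonneg_iff_analyticAt]
  exact ⟨D.analyticAt_rep_of_analyticAt h h', D.analyticAt_rep_of_analyticAt h' h⟩

lemma not_isPole_symm_iff {e : HolChart S} {z : ℂ} (h : z ∈ e.1.target) :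
    ¬ D.IsPole (e.1.symm z) ↔ AnalyticAt ℂ (D.rep e) z := by
  rw [D.not_isPole_iff (e.1.map_target h), e.1.right_inv h]

lemma eventually_not_isPole {e : HolChart S} {p : S} (h : p ∈ e.1.source) :
    ∀ᶠ z in 𝓝[≠] (e.1 p), ¬ D.IsPole (e.1.symm z) := by
  filter_upwards [(D.meromorphic e (e.1.map_source h)).meromorphicAt.eventually_analyticAt,
    (eventually_mem_target h).filter_mono nhdsWithin_le_nhds] with z hz hz'
  exact (D.not_isPole_symm_iff hz').2 hz

variable {D} in
lemma rep_eq {e e' : HolChart S} {p : S} (h : p ∈ e.1.source) (h' : p ∈ e'.1.source)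
    (hp : ¬ D.IsPole p) :
    D.rep e (e.1 p) = D.rep e' (e'.1 p) * deriv (transition e e') (e.1 p)
      + deriv (deriv (transition e e')) (e.1 p) / deriv (transition e e') (e.1 p) := by
  have h1 := D.analyticAt_transform h h' ((D.not_isPole_iff h').1 hp)
  have := ((((D.not_isPole_iff h).1 hp).continuousAt.eventuallyEq_nhds_iff_eventuallyEq_nhdsNE
    h1.continuousAt).1 (D.transform e e' p h h')).self_of_nhds
  dsimp only at this
  rwa [transition_apply e' h] at this

/-- Around a point that is not a pole there is a coordinate in which the connection is trivial. -/
lemma exists_flat_chart {p : S} (hp : ¬ D.IsPole p) :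
    ∃ (f : HolChart S) (r : ℝ), 0 < r ∧ p ∈ f.1.source ∧ f.1.target = Metric.ball (f.1 p) r ∧
      ∀ x ∈ f.1.source, ¬ D.IsPole x ∧ D.rep f (f.1 x) = 0 := by
  set e := chartOf p
  have h : p ∈ e.1.source := mem_chartOf_source p
  have ha := (D.not_isPole_iff h).1 hp
  -- A flat coordinate `w` satisfies `w''/w' = η`; integrate twice, with `H' = η` and `w' = exp H`.
  obtain ⟨H, hH, hH'⟩ := ha.exists_primitive
  obtain ⟨G, hG, hG'⟩ := hH.cexp.exists_primitive
  obtain ⟨f, r, hr, hf, hft, hfx⟩ := exists_chart_comp h hG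
    (by rw [hG'.self_of_nhds.deriv]; exact Complex.exp_ne_zero _)
    (ha.eventually_analyticAt.and (hH'.and hG'.eventually_nhds))
  refine ⟨f, r, hr, hf, hft, fun x hx => ?_⟩
  obtain ⟨hxe, ⟨hxa, hxH, hxG⟩, hxf⟩ := hfx x hx
  have hxp := (D.not_isPole_iff hxe).2 hxa
  refine ⟨hxp, ?_⟩
  have h1 := rep_eq hxe hx hxp
  have h2 : deriv (transition e f) =ᶠ[𝓝 (e.1 x)] fun z => Complex.exp (H z) :=
    hxf.deriv.trans (hxG.mono fun z hz => hz.deriv)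
  rw [h2.deriv_eq, h2.eq_of_nhds, hxH.cexp.deriv] at h1
  have h3 := Complex.exp_ne_zero (H (e.1 x))
  rw [mul_div_cancel_left₀ _ h3, right_eq_add, mul_eq_zero] at h1
  exact h1.resolve_right h3

end MeromorphicConnection

end Reps

/-! ### Geodesics and the local meaning of adaptedness -/

section Geodesics

variable {S : Type*} [TopologicalSpace S] [ChartedSpace ℂ S] [IsManifold 𝓘(ℂ) ω S]

/-- With `c = q'/(kq)`, the gradient of the logarithm of the length element is `conj c`, and `2
Re(cv) v - |v|^2 conj c = c v^2`. -/
lemma KDifferential.conformalGeodesicEq_iff {k : ℕ} {q : KDifferential k S} {e : HolChart S}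
    {I : Set ℝ} {σ : ℝ → S} {t : ℝ} (h : σ t ∈ e.1.source) (hq : ¬ q.IsCritical (σ t)) :
    ConformalGeodesicEq e (q.lengthElement e) I σ t ↔
      secondDeriv e I σ t
        + logDeriv (q.rep e) (e.1 (σ t)) / k * velocity e I σ t ^ 2 = 0 := by
  have h1 := hasFDerivAt_log_norm_rpow (analyticAt_rep h hq).differentiableAt.hasDerivAt
    ((q.not_isCritical_iff h).1 hq) (1 / (k : ℝ))
  have h2 : HasGradientAt (fun w => Real.log (q.lengthElement e w)) _ _ := h1
  rw [ConformalGeodesicEq, h2.gradient, h2.hasFDerivAt.fderiv]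
  set v := velocity e I σ t
  set L := deriv (q.rep e) (e.1 (σ t)) / q.rep e (e.1 (σ t)) with hL
  have key : (2 * (InnerProductSpace.toDual ℝ ℂ
        (starRingEnd ℂ (((1 / (k : ℝ) : ℝ) : ℂ) * L))) v) • v
      - ‖v‖ ^ 2 • starRingEnd ℂ (((1 / (k : ℝ) : ℝ) : ℂ) * L) = L / k * v ^ 2 := by
    rw [InnerProductSpace.toDual_apply_apply, Complex.inner, Complex.conj_conj,
      Complex.real_smul, Complex.real_smul]
    push_cast
    rw [Complex.re_eq_add_conj, ← Complex.mul_conj']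
    simp only [map_mul, map_div₀, map_one, Complex.conj_natCast]
    ring
  rw [add_sub_assoc, key, logDeriv_apply]

/-- Straight lines in a flat coordinate are geodesics. The nonzero velocity is what lets geodesics
determine the coefficient of the equation. -/
lemma MeromorphicConnection.exists_isGeodesic (D : MeromorphicConnection S) {p : S}
    (hp : ¬ D.IsPole p) {e : HolChart S} (h : p ∈ e.1.source) :
    ∃ (I : Set ℝ) (σ : ℝ → S) (t : ℝ), D.IsGeodesic I σ ∧ t ∈ I ∧ σ t = p ∧
      velocity e I σ t ≠ 0 := by
  obtain ⟨f, r, hr, hpf, hft, hf⟩ := D.exists_flat_chart hp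
  set I : Set ℝ := Set.Ioo (-r) r
  set ℓ : ℝ → ℂ := fun s => f.1 p + s
  set σ : ℝ → S := fun s => f.1.symm (ℓ s)
  have hℓ : ∀ s ∈ I, ℓ s ∈ f.1.target := by
    intro s hs
    rw [hft]
    simp [ℓ, abs_lt, hs.1, hs.2]
  have hσ : ∀ s ∈ I, σ s ∈ f.1.source := fun s hs => f.1.map_target (hℓ s hs)
  have hfσ : ∀ s ∈ I, f.1 (σ s) = ℓ s := fun s hs => f.1.right_inv (hℓ s hs)
  have hI : IsOpen I := isOpen_Ioo
  have hℓ' : ∀ s, HasDerivAt ℓ 1 s := fun s => Complex.ofRealCLM.hasDerivAt.const_add _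
  have han : ∀ s ∈ I, ∀ e : HolChart S, σ s ∈ e.1.source →
      AnalyticAt ℂ (transition f e) (ℓ s) := fun s hs e hse => by
    rw [← hfσ s hs]
    exact analyticAt_transition (hσ s hs) hse
  have hvel : ∀ s ∈ I, ∀ e : HolChart S, σ s ∈ e.1.source →
      velocity e I σ s = deriv (transition f e) (ℓ s) := fun s hs e hse => by
    rw [velocity, derivWithin_of_isOpen hI hs]
    have := (han s hs e hse).differentiableAt.hasDerivAt.comp_of_eq s (hℓ' s) rfl
    rw [mul_one] at this
    exact this.deriv
  have hmem : ∀ s ∈ I, ∀ e : HolChart S, σ s ∈ e.1.source →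
      ∀ᶠ u in 𝓝 s, u ∈ I ∧ σ u ∈ e.1.source := fun s hs e hse =>
    Eventually.and (hI.mem_nhds hs) (((f.1.symm.continuousAt (hℓ s hs)).comp
      (hℓ' s).continuousAt).eventually (e.1.open_source.mem_nhds hse))
  have hacc : ∀ s ∈ I, ∀ e : HolChart S, σ s ∈ e.1.source →
      secondDeriv e I σ s = deriv (deriv (transition f e)) (ℓ s) := fun s hs e hse => by
    rw [secondDeriv, derivWithin_of_isOpen hI hs]
    have h1 : (fun u => velocity e I σ u) =ᶠ[𝓝 s] fun u => deriv (transition f e) (ℓ u) :=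
      (hmem s hs e hse).mono fun u hu => hvel u hu.1 e hu.2
    have := (han s hs e hse).deriv.differentiableAt.hasDerivAt.comp_of_eq s (hℓ' s) rfl
    rw [mul_one] at this
    exact h1.deriv_eq.trans this.deriv
  have h0 : (0 : ℝ) ∈ I := by simp [I, hr]
  have hσ0 : σ 0 = p := by simp [σ, ℓ, f.1.left_inv hpf]
  refine ⟨I, σ, 0, ⟨⟨Set.ordConnected_Ioo, ?_, ?_, ?_⟩, fun s hs => (hf _ (hσ s hs)).1, ?_⟩,
    h0, hσ0, ?_⟩
  · rw [hI.interior_eq]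
    exact ⟨0, h0⟩
  · exact fun s hs => ((f.1.symm.continuousAt (hℓ s hs)).comp
      (hℓ' s).continuousAt).continuousWithinAt
  · intro s hs e hse
    have h1 : ContDiffAt ℝ ∞ (transition f e) (ℓ s) :=
      ((han s hs e hse).contDiffAt (n := ∞)).restrict_scalars ℝ
    have h2 : ContDiff ℝ ∞ ℓ := contDiff_const.add Complex.ofRealCLM.contDiff
    exact (h1.comp s h2.contDiffAt).contDiffWithinAt
  · intro s hs e hse
    rw [hacc s hs e hse, hvel s hs e hse]
    obtain ⟨h1, h2⟩ := hf _ (hσ s hs)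
    -- Velocity and acceleration are `τ'` and `τ''` for the transition `τ` out of the flat chart,
    -- whose law reads `0 = η τ' + τ''/τ'`.
    have h3 := rep_eq (hσ s hs) hse h1
    have h4 := deriv_transition_ne_zero (hσ s hs) hse
    rw [hfσ s hs] at h2 h3 h4
    rw [h2] at h3
    field_simp at h3
    linear_combination -h3
  · rw [hvel 0 h0 e (by rwa [hσ0]), ← hfσ 0 h0, hσ0]
    exact deriv_transition_ne_zero hpf h

/-- The `k`-differential `q` is a parallel section for the connection induced by `D`, away from
the critical points. -/
def IsParallel {k : ℕ} (D : MeromorphicConnection S) (q : KDifferential k S) : Prop :=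
  ∀ (e : HolChart S) (p : S), p ∈ e.1.source → ¬ q.IsCritical p →
    D.rep e (e.1 p) = logDeriv (q.rep e) (e.1 p) / k

/-- Both geodesic equations have the form `z'' + c z'^2 = 0`; a geodesic with `z' ≠ 0` at the given
point forces the coefficients to agree there. -/
theorem adapted_iff {k : ℕ} {D : MeromorphicConnection S} {q : KDifferential k S} :
    Adapted D q ↔ (∀ p, D.IsPole p ↔ q.IsCritical p) ∧ IsParallel D q := by
  refine and_congr_right fun hcrit => ⟨fun hgeo e p h hp => ?_, fun hpar I σ => ?_⟩
  · obtain ⟨I, σ, t, hσ, ht, rfl, hv⟩ := D.exists_isGeodesic (mt (hcrit p).1 hp) h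
    have h1 := hσ.2.2 t ht e h
    have h2 := (KDifferential.conformalGeodesicEq_iff h hp).1 (((hgeo I σ).1 hσ).2.2 t ht e h)
    exact mul_right_cancel₀ (pow_ne_zero 2 hv) (add_left_cancel (h1.trans h2.symm))
  · simp only [MeromorphicConnection.IsGeodesic, KDifferential.IsGeodesic, hcrit]
    refine and_congr_right fun _ => and_congr_right fun hc => forall₂_congr fun t ht =>
      forall₂_congr fun e he => ?_
    rw [KDifferential.conformalGeodesicEq_iff he (hc t ht), hpar e _ he (hc t ht)]

end Geodesics

/-! ### The connection of a differential: poles and residues -/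

section Induced

lemma forall_of_eventually_nhds {S : Type*} [TopologicalSpace S] [PreconnectedSpace S]
    {P : S → Prop} {p : S} (hp : P p)
    (h1 : ∀ x, P x → ∀ᶠ y in 𝓝 x, P y) (h2 : ∀ x, ¬ P x → ∀ᶠ y in 𝓝 x, ¬ P y) (x : S) : P x := by
  have hclopen : IsClopen {x | P x} :=
    ⟨isOpen_compl_iff.1 (isOpen_iff_mem_nhds.2 h2), isOpen_iff_mem_nhds.2 h1⟩
  exact (hclopen.eq_univ ⟨p, hp⟩ ▸ Set.mem_univ x : x ∈ {x | P x})

variable {S : Type*} [TopologicalSpace S] [ChartedSpace ℂ S]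

lemma eventually_nhds_of_chart {P : S → Prop} {e : HolChart S} {p : S} (h : p ∈ e.1.source)
    (hP : ∀ᶠ z in 𝓝 (e.1 p), P (e.1.symm z)) : ∀ᶠ x in 𝓝 p, P x := by
  filter_upwards [(e.1.continuousAt h).eventually hP, e.1.open_source.mem_nhds h] with x hx hx'
  rwa [e.1.left_inv hx'] at hx

variable [IsManifold 𝓘(ℂ) ω S]

namespace KDifferential

variable {k : ℕ} {q : KDifferential k S}

lemma eventually_rep_ne_zero {e : HolChart S} {p : S} (h : p ∈ e.1.source)
    (hq : q.order p ≠ ⊤) : ∀ᶠ z in 𝓝[≠] (e.1 p), q.rep e z ≠ 0 := by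
  rw [q.order_eq h] at hq
  exact (meromorphicOrderAt_ne_top_iff_eventually_ne_zero
    (q.meromorphic e (e.1.map_source h)).meromorphicAt).1 hq

lemma eventually_rep_eq_zero {e : HolChart S} {p : S} (h : p ∈ e.1.source)
    (hq : q.order p = ⊤) : ∀ᶠ z in 𝓝 (e.1 p), q.rep e z = 0 := by
  rw [q.order_eq h, meromorphicOrderAt_eq_top_iff] at hq
  exact ((q.meromorphic e (e.1.map_source h)).eventuallyEq_nhdsNE_iff_eventuallyEq_nhds
    analyticAt_const.meromorphicNFAt).1 hq

lemma order_symm_eq_zero {e : HolChart S} {z : ℂ} (h : z ∈ e.1.target) (hz : q.rep e z ≠ 0) :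
    q.order (e.1.symm z) = 0 :=
  not_not.1 ((q.not_isCritical_symm_iff h).2 hz)

/-- Finite order and infinite order are both open conditions, so connectedness decides. -/
lemma IsNonzero.order_ne_top [PreconnectedSpace S] (hq : q.IsNonzero) (p : S) :
    q.order p ≠ ⊤ := by
  obtain ⟨e, z, hz⟩ := hq
  have hzt : z ∈ e.1.target := by
    by_contra hzt
    exact hz (q.rep_eq_zero e z hzt)
  refine forall_of_eventually_nhds (P := fun p => q.order p ≠ ⊤) (p := e.1.symm z)
    (by rw [order_symm_eq_zero hzt hz]; exact WithTop.zero_ne_top) (fun x hx => ?_)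
    (fun x hx => ?_) p
  · have h := mem_chartOf_source x
    refine eventually_nhds_of_chart h ?_
    have h1 := eventually_nhdsWithin_iff.1 (eventually_rep_ne_zero h hx)
    filter_upwards [h1, eventually_mem_target h] with w hw hwt
    by_cases hwx : w = (chartOf x).1 x
    · rwa [hwx, (chartOf x).1.left_inv h]
    · rw [order_symm_eq_zero hwt (hw hwx)]
      exact WithTop.zero_ne_top
  · have h := mem_chartOf_source x
    refine eventually_nhds_of_chart h ?_
    filter_upwards [(eventually_rep_eq_zero h (not_not.1 hx)).eventually_nhds,
      eventually_mem_target h] with w hw hwt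
    rw [not_not, q.order_eq ((chartOf x).1.map_target hwt), (chartOf x).1.right_inv hwt,
      meromorphicOrderAt_eq_top_iff]
    exact hw.filter_mono nhdsWithin_le_nhds

lemma logDeriv_rep_eq {e e' : HolChart S} {p : S} (h : p ∈ e.1.source) (h' : p ∈ e'.1.source)
    (hp : ¬ q.IsCritical p) :
    logDeriv (q.rep e) (e.1 p) = logDeriv (q.rep e') (e'.1 p) * deriv (transition e e') (e.1 p)
      + k * (deriv (deriv (transition e e')) (e.1 p) / deriv (transition e e') (e.1 p)) := by
  have ht := analyticAt_transition h h'
  have hd := deriv_transition_ne_zero h h'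
  have ha := analyticAt_rep h' hp
  have h0 := (q.not_isCritical_iff h').1 hp
  have heq : q.rep e =ᶠ[𝓝 (e.1 p)] fun z =>
      (deriv (transition e e') z) ^ k * (q.rep e' ∘ transition e e') z := q.eventually_rep_eq h h'
  rw [← transition_apply e' h] at ha h0 ⊢
  rw [(logDeriv_congr_nhds heq).eq_of_nhds, logDeriv_mul
    (f := fun z => deriv (transition e e') z ^ k) (e.1 p) (pow_ne_zero k hd) h0
    (ht.deriv.pow k).differentiableAt (ha.comp ht).differentiableAt,
    logDeriv_fun_pow ht.deriv.differentiableAt, logDeriv_comp ha.differentiableAt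
    ht.differentiableAt, logDeriv_apply (deriv (transition e e'))]
  ring

/-- The connection for which a given `k`-differential is parallel. -/
def connection (q : KDifferential k S) (hk : k ≠ 0) (hq : ∀ p, q.order p ≠ ⊤) :
    MeromorphicConnection S where
  rep e z := logDeriv (q.rep e) z / k
  meromorphic e z hz := by
    have hnf := q.meromorphic e hz
    have hlog : MeromorphicNFAt (logDeriv (q.rep e)) z := by
      rw [meromorphicNFAt_iff_analyticAt_or]
      -- At a zero or pole of `q` the logarithmic derivative has a simple pole, and division by the
      -- value `0` gives it the value `0` that a normal form requires.
      by_cases h0 : q.rep e z = 0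
      · right
        have ho := q.order_eq (e.1.map_target hz)
        rw [e.1.right_inv hz] at ho
        refine ⟨hnf.meromorphicAt.deriv.div hnf.meromorphicAt, ?_, by simp [logDeriv_apply, h0]⟩
        rw [meromorphicOrderAt_logDeriv_eq_neg_one hnf.meromorphicAt
          (fun h => hnf.meromorphicOrderAt_eq_zero_iff.1 h h0) (ho ▸ hq _)]
        exact WithTop.coe_lt_zero.2 (by norm_num)
      · left
        have := hnf.meromorphicOrderAt_nonneg_iff_analyticAt.1
          (hnf.meromorphicOrderAt_eq_zero_iff.2 h0).ge
        exact this.deriv.div this h0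
    simp only [div_eq_mul_inv]
    exact (meromorphicNFAt_mul_iff_left analyticAt_const (by simpa)).2 hlog
  rep_eq_zero e z hz := by simp [logDeriv_apply, q.rep_eq_zero e z hz]
  transform e e' p h h' := by
    filter_upwards [eventually_rep_ne_zero h (hq p), (eventually_symm_mem_source h
      h').filter_mono nhdsWithin_le_nhds] with z hz ⟨hzt, hzs⟩
    have h1 := logDeriv_rep_eq (e.1.map_target hzt) hzs ((q.not_isCritical_symm_iff hzt).2 hz)
    rw [e.1.right_inv hzt] at h1
    have hk' : (k : ℂ) ≠ 0 := Nat.cast_ne_zero.2 hk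
    rw [h1, transition]
    field_simp

lemma adapted_connection (hk : k ≠ 0) (hq : ∀ p, q.order p ≠ ⊤) :
    Adapted (q.connection hk hq) q := by
  refine adapted_iff.2 ⟨fun p => ?_, fun e p h hp => rfl⟩
  have h := mem_chartOf_source p
  have hm := (q.meromorphic _ ((chartOf p).1.map_source h)).meromorphicAt
  constructor
  · intro hpole
    by_contra hp
    have ha := analyticAt_rep h hp
    refine ((q.connection hk hq).not_isPole_iff h).2 ?_ hpole
    exact (ha.deriv.div ha ((q.not_isCritical_iff h).1 hp)).div_const
  · intro hp
    have h1 : (q.connection hk hq).rep (chartOf p)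
        = (fun _ => (k : ℂ)⁻¹) * logDeriv (q.rep (chartOf p)) := by
      ext z
      simp only [connection, Pi.mul_apply]
      ring
    rw [MeromorphicConnection.IsPole, MeromorphicConnection.order, h1,
      meromorphicOrderAt_mul_of_ne_zero analyticAt_const (by simpa),
      meromorphicOrderAt_logDeriv_eq_neg_one hm hp (hq p)]
    exact WithTop.coe_lt_zero.2 (by norm_num)

end KDifferential

namespace Adapted

variable {k : ℕ} {D : MeromorphicConnection S} {q : KDifferential k S}

lemma isCritical_iff (h : Adapted D q) (p : S) : q.IsCritical p ↔ D.IsPole p := (h.1 p).symm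

/-- If `q` vanished near `p`, all points nearby would be critical, hence poles of the connection;
but poles are isolated. -/
lemma order_ne_top (hD : Adapted D q) (p : S) : q.order p ≠ ⊤ := by
  intro hp
  have h := mem_chartOf_source p
  obtain ⟨z, hz, hz0, hzt⟩ := ((D.eventually_not_isPole h).and
    (((KDifferential.eventually_rep_eq_zero h hp).and
      (eventually_mem_target h)).filter_mono nhdsWithin_le_nhds)).exists
  exact (q.not_isCritical_symm_iff hzt).1 (mt (hD.isCritical_iff _).1 hz) hz0

lemma rep_eq (hD : Adapted D q) {e : HolChart S} {z : ℂ} (hz : q.rep e z ≠ 0) :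
    D.rep e z = logDeriv (q.rep e) z / k := by
  have hzt : z ∈ e.1.target := by
    by_contra hzt
    exact hz (q.rep_eq_zero e z hzt)
  have := (adapted_iff.1 hD).2 e _ (e.1.map_target hzt) ((q.not_isCritical_symm_iff hzt).2 hz)
  rwa [e.1.right_inv hzt] at this

lemma eventually_rep_eq (hD : Adapted D q) {e : HolChart S} {p : S} (h : p ∈ e.1.source) :
    ∀ᶠ z in 𝓝[≠] (e.1 p), D.rep e z = logDeriv (q.rep e) z / k :=
  (KDifferential.eventually_rep_ne_zero h (hD.order_ne_top p)).mono fun _ hz => hD.rep_eq hz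

/-- A connection is determined by any `k`-differential adapted to it. -/
lemma connection_unique {D' : MeromorphicConnection S} (hD : Adapted D q) (hD' : Adapted D' q) :
    D = D' := by
  ext e z
  by_cases hz : z ∈ e.1.target
  · have h := e.1.map_target hz
    have h1 : D.rep e =ᶠ[𝓝[≠] (e.1 (e.1.symm z))] D'.rep e := by
      filter_upwards [hD.eventually_rep_eq h, hD'.eventually_rep_eq h] with w hw hw'
      rw [hw, hw']
    rw [e.1.right_inv hz] at h1
    exact (((D.meromorphic e hz).eventuallyEq_nhdsNE_iff_eventuallyEq_nhds
      (D'.meromorphic e hz)).1 h1).eq_of_nhds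
  · rw [D.rep_eq_zero e z hz, D'.rep_eq_zero e z hz]

lemma exists_simple_pole (hD : Adapted D q) (p : S) {n : ℤ} (hn : q.order p = n) :
    ∃ g : ℂ → ℂ, AnalyticAt ℂ g ((chartOf p).1 p) ∧ g ((chartOf p).1 p) = n / k ∧
      ∀ᶠ z in 𝓝[≠] ((chartOf p).1 p), D.rep (chartOf p) z = (z - (chartOf p).1 p)⁻¹ * g z := by
  have h := mem_chartOf_source p
  have hm := (q.meromorphic _ ((chartOf p).1.map_source h)).meromorphicAt
  obtain ⟨g, hg, hgn, hgl⟩ := exists_logDeriv_eq_of_meromorphicOrderAt_eq hm hn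
  refine ⟨fun z => g z / k, hg.div_const, by simp only [hgn], ?_⟩
  filter_upwards [hgl, hD.eventually_rep_eq h] with z hz hz'
  rw [hz', hz, mul_div_assoc]

lemma isFuchsian (hk : k ≠ 0) (hD : Adapted D q) : D.IsFuchsian := by
  intro p hp
  obtain ⟨n, hn⟩ := WithTop.ne_top_iff_exists.1 (hD.order_ne_top p)
  obtain ⟨g, hg, hgn, hgl⟩ := hD.exists_simple_pole p hn.symm
  -- A pole is a critical point, so the coefficient `n / k` of the polar part does not vanish.
  have h0 : n ≠ 0 := by
    rintro rfl
    exact (hD.isCritical_iff p).2 hp hn.symm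
  have hm := (D.meromorphic _ ((chartOf p).1.map_source (mem_chartOf_source p))).meromorphicAt
  refine (meromorphicOrderAt_eq_int_iff (n := -1) hm).2 ⟨g, hg, ?_, ?_⟩
  · rw [hgn]
    exact div_ne_zero (Int.cast_ne_zero.2 h0) (Nat.cast_ne_zero.2 hk)
  · filter_upwards [hgl] with z hz
    rw [hz, zpow_neg_one, smul_eq_mul]

lemma hasResiduesIn (hD : Adapted D q) : D.HasResiduesIn k := by
  intro p
  obtain ⟨n, hn⟩ := WithTop.ne_top_iff_exists.1 (hD.order_ne_top p)
  obtain ⟨g, hg, hgn, hgl⟩ := hD.exists_simple_pole p hn.symm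
  exact ⟨n, (residue_eq_of_eventually_eq hg hgl).trans hgn⟩

end Adapted

end Induced

/-! ### Natural coordinates, affine transitions and monodromy -/

lemma eventually_eq_of_hasDerivAt_zero {f : ℂ → ℂ} {x : ℂ} (h : ∀ᶠ z in 𝓝 x, HasDerivAt f 0 z) :
    ∀ᶠ z in 𝓝 x, f z = f x := by
  obtain ⟨c, hc⟩ := exists_eventually_eq_const_of_hasDerivAt_zero
    (h.filter_mono nhdsWithin_le_nhds)
  have h1 := (h.self_of_nhds.continuousAt.eventuallyEq_nhds_iff_eventuallyEq_nhdsNE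
    (continuousAt_const (y := c))).1 hc
  exact h1.mono fun z hz => hz.trans h1.self_of_nhds.symm

lemma eventually_eq_affine {f : ℂ → ℂ} {x : ℂ} (hf : AnalyticAt ℂ f x)
    (h : ∀ᶠ z in 𝓝 x, deriv (deriv f) z = 0) :
    ∀ᶠ z in 𝓝 x, f z = deriv f x * z + (f x - deriv f x * x) := by
  have h1 : ∀ᶠ z in 𝓝 x, deriv f z = deriv f x := by
    apply eventually_eq_of_hasDerivAt_zero
    filter_upwards [h, hf.eventually_analyticAt] with z hz hfz
    rw [← hz]
    exact hfz.deriv.differentiableAt.hasDerivAt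
  have h2 : ∀ᶠ z in 𝓝 x, HasDerivAt (fun w => f w - deriv f x * w) 0 z := by
    filter_upwards [h1, hf.eventually_analyticAt] with z hz hfz
    refine (hfz.differentiableAt.hasDerivAt.sub
      ((hasDerivAt_id z).const_mul (deriv f x))).congr_deriv ?_
    rw [hz]
    ring
  filter_upwards [eventually_eq_of_hasDerivAt_zero h2] with z hz
  linear_combination hz

lemma affine_coeff_unique {a a' c c' w : ℂ}
    (h : ∀ᶠ z in 𝓝 w, a * z + c = a' * z + c') : a = a' ∧ c = c' := by
  have hd : ∀ b d : ℂ, deriv (fun z => b * z + d) w = b := fun b d =>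
    ((((hasDerivAt_id w).const_mul b).add_const d).congr_deriv (mul_one b)).deriv
  have h1 := EventuallyEq.deriv_eq h
  rw [hd, hd] at h1
  refine ⟨h1, ?_⟩
  have h2 := h.self_of_nhds
  rw [h1] at h2
  exact add_left_cancel h2

section Monodromy

variable {S : Type*} [TopologicalSpace S] [ChartedSpace ℂ S]

lemma rep_restrictTarget {k : ℕ} (q : KDifferential k S) (e : HolChart S) {U : Set ℂ}
    (hU : IsOpen U) {p : S} (h : p ∈ (restrictTarget e hU).1.source) :
    q.rep (restrictTarget e hU) (e.1 p) = q.rep e (e.1 p) := by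
  have h' := ((mem_restrictTarget_source hU).1 h).1
  have h1 : deriv (transition (restrictTarget e hU) e) (e.1 p) = 1 :=
    deriv_transition_self (e := e) h'
  have h2 := q.rep_eq h h'
  rwa [restrictTarget_apply, h1, one_pow, one_mul] at h2

variable [IsManifold 𝓘(ℂ) ω S] {k : ℕ} {q : KDifferential k S}

/-- Around a point that is not critical there is a coordinate `z` with `q = dz ^ k`. -/
lemma KDifferential.exists_natural_chart (hk : k ≠ 0) {p : S} (hp : ¬ q.IsCritical p) :
    ∃ (f : HolChart S) (r : ℝ), 0 < r ∧ p ∈ f.1.source ∧ f.1.target = Metric.ball (f.1 p) r ∧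
      ∀ x ∈ f.1.source, q.rep f (f.1 x) = 1 := by
  set e := chartOf p
  have h : p ∈ e.1.source := mem_chartOf_source p
  have ha := KDifferential.analyticAt_rep h hp
  have h0 := (q.not_isCritical_iff h).1 hp
  have hk' : (k : ℂ) ≠ 0 := Nat.cast_ne_zero.2 hk
  set q₀ := q.rep e (e.1 p)
  obtain ⟨α, hα⟩ := IsAlgClosed.exists_pow_nat_eq q₀ (Nat.pos_of_ne_zero hk)
  have hα0 : α ≠ 0 := by
    rintro rfl
    rw [zero_pow hk] at hα
    exact h0 hα.symm
  -- A holomorphic branch of `q^(1/k)` near the point; its primitive is the natural coordinate.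
  set g : ℂ → ℂ := fun z => α * Complex.exp (Complex.log (q.rep e z / q₀) / k)
  have hlog : AnalyticAt ℂ (fun z => Complex.log (q.rep e z / q₀)) (e.1 p) :=
    ha.div_const.clog (by rw [div_self h0]; exact Complex.one_mem_slitPlane)
  have hg : AnalyticAt ℂ g (e.1 p) := analyticAt_const.mul hlog.div_const.cexp
  have hg0 : ∀ z, g z ≠ 0 := fun z => mul_ne_zero hα0 (Complex.exp_ne_zero _)
  have hgk : ∀ z, q.rep e z ≠ 0 → g z ^ k = q.rep e z := fun z hz => by
    rw [mul_pow, ← Complex.exp_nat_mul, mul_div_cancel₀ _ hk',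
      Complex.exp_log (div_ne_zero hz h0), hα, mul_div_cancel₀ _ h0]
  obtain ⟨G, hG, hG'⟩ := hg.exists_primitive
  obtain ⟨f, r, hr, hf, hft, hfx⟩ := exists_chart_comp h hG
    (by rw [hG'.self_of_nhds.deriv]; exact hg0 _)
    ((ha.continuousAt.eventually_ne h0).and hG')
  refine ⟨f, r, hr, hf, hft, fun x hx => ?_⟩
  obtain ⟨hxe, ⟨hx0, hxG⟩, hxf⟩ := hfx x hx
  have h1 := q.rep_eq hxe hx
  rw [hxf.deriv_eq, hxG.deriv, hgk _ hx0] at h1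
  exact (left_eq_mul₀ hx0).1 h1

omit [IsManifold 𝓘(ℂ) ω S] in
lemma KDifferential.logDeriv_eq_zero_of_rep_eq_one {e : HolChart S}
    (he : ∀ x ∈ e.1.source, q.rep e (e.1 x) = 1) {z : ℂ} (hz : z ∈ e.1.target) :
    logDeriv (q.rep e) z = 0 := by
  have h1 : q.rep e =ᶠ[𝓝 z] fun _ => (1 : ℂ) := by
    filter_upwards [e.1.open_target.mem_nhds hz] with w hw
    rw [← he _ (e.1.map_target hw), e.1.right_inv hw]
  rw [(logDeriv_congr_nhds h1).eq_of_nhds, logDeriv_const, Pi.zero_apply]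

/-- Two natural coordinates differ locally by an affine map. -/
lemma eventually_transition_eq_affine (hk : k ≠ 0) {e e' : HolChart S}
    (he : ∀ x ∈ e.1.source, q.rep e (e.1 x) = 1)
    (he' : ∀ x ∈ e'.1.source, q.rep e' (e'.1 x) = 1) {p : S} (h : p ∈ e.1.source)
    (h' : p ∈ e'.1.source) :
    ∃ a c : ℂ, a ^ k = 1 ∧ ∀ᶠ z in 𝓝 (e.1 p), transition e e' z = a * z + c := by
  have ht := analyticAt_transition h h'
  refine ⟨_, _, ?_, eventually_eq_affine ht ?_⟩
  · have h1 := q.rep_eq h h'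
    rw [he p h, he' p h', mul_one] at h1
    exact h1.symm
  · filter_upwards [eventually_symm_mem_source h h'] with z ⟨hz, hz'⟩
    have hx := e.1.map_target hz
    have h1 := KDifferential.logDeriv_rep_eq hx hz' ((q.not_isCritical_iff hx).2
      (by rw [he _ hx]; exact one_ne_zero))
    rw [e.1.right_inv hz, KDifferential.logDeriv_eq_zero_of_rep_eq_one he hz,
      KDifferential.logDeriv_eq_zero_of_rep_eq_one he' (e'.1.map_source hz'), zero_mul,
      zero_add] at h1
    have hd := deriv_transition_ne_zero hx hz'
    rw [e.1.right_inv hz] at hd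
    have hk' : (k : ℂ) ≠ 0 := Nat.cast_ne_zero.2 hk
    have h2 := (mul_eq_zero.1 h1.symm).resolve_left hk'
    exact (div_eq_zero_iff.1 h2).resolve_right hd

/-- A disc in a natural coordinate that meets a smaller or equal disc of a second natural
coordinate, defined on a disc of four times the radius, is contained in the domain of the
latter, and the two coordinates differ by a single affine map. -/
lemma exists_affine_on_disc [T2Space S] (hk : k ≠ 0) {e e' : HolChart S}
    (he : ∀ x ∈ e.1.source, q.rep e (e.1 x) = 1)
    (he' : ∀ x ∈ e'.1.source, q.rep e' (e'.1 x) = 1) {z₀ z₁ : ℂ} {r r' : ℝ} (hr : r ≤ r')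
    (ht : Metric.ball z₀ r ⊆ e.1.target) (ht' : Metric.ball z₁ (4 * r') ⊆ e'.1.target) {p : S}
    (h : p ∈ e.1.source) (hp : e.1 p ∈ Metric.ball z₀ r) (h' : p ∈ e'.1.source)
    (hp' : e'.1 p ∈ Metric.ball z₁ r') :
    ∃ a c : ℂ, a ^ k = 1 ∧ ∀ x ∈ e.1.source, e.1 x ∈ Metric.ball z₀ r →
      e'.1 x = a * e.1 x + c := by
  obtain ⟨a, c, ha, hac⟩ := eventually_transition_eq_affine hk he he' h h'
  have hna : ‖a‖ = 1 := Complex.norm_eq_one_of_pow_eq_one ha hk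
  refine ⟨a, c, ha, ?_⟩
  -- `T` is open; showing it relatively closed in the disc lets connectedness propagate the affine
  -- relation.
  set T : Set ℂ := {z | z ∈ e.1.target ∧ e.1.symm z ∈ e'.1.source ∧
    ∀ᶠ w in 𝓝 z, transition e e' w = a * w + c}
  have hTo : IsOpen T := by
    rw [isOpen_iff_mem_nhds]
    rintro z ⟨hz, hz', hza⟩
    have h1 := eventually_symm_mem_source (e.1.map_target hz) hz'
    rw [e.1.right_inv hz] at h1
    filter_upwards [h1, hza.eventually_nhds] with w hw hw'
    exact ⟨hw.1, hw.2, hw'⟩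
  have hpac : e'.1 p = a * e.1 p + c := by
    rw [← transition_apply e' h]
    exact hac.self_of_nhds
  have hsub : Metric.ball z₀ r ⊆ T := by
    refine (convex_ball z₀ r).isPreconnected.subset_of_closure_inter_subset hTo
      ⟨e.1 p, hp, e.1.map_source h, by rwa [e.1.left_inv h], hac⟩ ?_
    rintro w ⟨hwT, hwB⟩
    have hwt := ht hwB
    -- As `‖a‖ = 1`, the image of `w` lies within `r + r + r' ≤ 3r'` of `z₁`.
    have hyt : a * w + c ∈ e'.1.target := by
      apply ht'
      rw [Metric.mem_ball, dist_eq_norm] at *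
      have h1 : a * w + c - z₁ = a * (w - z₀) - a * (e.1 p - z₀) + (e'.1 p - z₁) := by
        rw [hpac]; ring
      have h2 : ‖a * (w - z₀)‖ = ‖w - z₀‖ := by rw [norm_mul, hna, one_mul]
      have h3 : ‖a * (e.1 p - z₀)‖ = ‖e.1 p - z₀‖ := by rw [norm_mul, hna, one_mul]
      have h4 := norm_add_le (a * (w - z₀) - a * (e.1 p - z₀)) (e'.1 p - z₁)
      have h5 := norm_sub_le (a * (w - z₀)) (a * (e.1 p - z₀))
      have h6 := norm_nonneg (w - z₀)
      rw [h1]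
      linarith
    have hfreq : ∃ᶠ z in 𝓝 w, z ∈ T := mem_closure_iff_frequently.1 hwT
    -- Both sides are limits of the same points of `S` as `z → w` in `T`; limits are unique since
    -- `S` is Hausdorff.
    have hws : e.1.symm w = e'.1.symm (a * w + c) := by
      refine tendsto_nhds_unique_of_frequently_eq (f := e.1.symm)
        (g := fun z => e'.1.symm (a * z + c)) (e.1.symm.continuousAt hwt) ?_ (hfreq.mono ?_)
      · exact (e'.1.symm.continuousAt hyt).comp (f := fun z => a * z + c) (by fun_prop)
      · rintro z ⟨hz, hz', hza⟩
        rw [← hza.self_of_nhds, transition, e'.1.left_inv hz']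
    have hws' : e.1.symm w ∈ e'.1.source := hws ▸ e'.1.map_target hyt
    obtain ⟨a', c', -, hac'⟩ :=
      eventually_transition_eq_affine hk he he' (e.1.map_target hwt) hws'
    rw [e.1.right_inv hwt] at hac'
    obtain ⟨z, ⟨-, -, hza⟩, hza'⟩ := (hfreq.and_eventually hac'.eventually_nhds).exists
    obtain ⟨rfl, rfl⟩ := affine_coeff_unique
      ((hza.and hza').mono fun u hu => hu.1.symm.trans hu.2)
    exact ⟨hwt, hws', hac'⟩
  intro x hx hxB
  have := (hsub hxB).2.2.self_of_nhds
  rwa [transition_apply e' hx] at this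

/-- One affine map must serve a whole overlap, which could be disconnected. The atlas therefore
consists of natural discs shrunk to a quarter of their radius: of two that meet, the smaller lies in
the full disc of the larger. -/
lemma Adapted.hasMonodromyIn [T2Space S] (hk : k ≠ 0) {D : MeromorphicConnection S}
    (hD : Adapted D q) : D.HasMonodromyIn (rootsOfUnity k ℂ) := by
  have hex : ∀ p : S, ∃ (f : HolChart S) (r : ℝ), ¬ q.IsCritical p → 0 < r ∧ p ∈ f.1.source ∧
      f.1.target = Metric.ball (f.1 p) r ∧ ∀ x ∈ f.1.source, q.rep f (f.1 x) = 1 := fun p => by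
    by_cases hp : q.IsCritical p
    · exact ⟨chartOf p, 0, fun h => (h hp).elim⟩
    · obtain ⟨f, r, h⟩ := KDifferential.exists_natural_chart hk hp
      exact ⟨f, r, fun _ => h⟩
  choose f r hfr using hex
  have hr := fun p hp => (hfr p hp).1
  have hf := fun p hp => (hfr p hp).2.1
  have hft := fun p hp => (hfr p hp).2.2.1
  have hfx := fun p hp => (hfr p hp).2.2.2
  set B : S → Set ℂ := fun p => Metric.ball ((f p).1 p) (r p / 4)
  have hB : ∀ p, IsOpen (B p) := fun p => Metric.isOpen_ball
  set E : S → HolChart S := fun p => restrictTarget (f p) (hB p)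
  have hE1 : ∀ p, ¬ q.IsCritical p → ∀ x ∈ (E p).1.source, q.rep (E p) ((E p).1 x) = 1 := by
    intro p hp x hx
    exact (rep_restrictTarget q (f p) (hB p) hx).trans
      (hfx p hp x ((mem_restrictTarget_source (hB p)).1 hx).1)
  have hunit : ∀ a : ℂ, a ^ k = 1 → ∃ u ∈ rootsOfUnity k ℂ, (u : ℂ) = a := by
    intro a ha
    have ha0 : a ≠ 0 := by
      rintro rfl
      rw [zero_pow hk] at ha
      exact zero_ne_one ha
    exact ⟨Units.mk0 a ha0, (mem_rootsOfUnity' k _).2 (by simpa using ha), rfl⟩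
  have haff : ∀ p p', ¬ q.IsCritical p → ¬ q.IsCritical p' → r p ≤ r p' → ∀ y,
      y ∈ (E p).1.source → y ∈ (E p').1.source → ∃ a c : ℂ, a ^ k = 1 ∧
        ∀ x ∈ (E p).1.source ∩ (E p').1.source, (E p').1 x = a * (E p).1 x + c := by
    intro p p' hp hp' hrr y hy hy'
    obtain ⟨h1, h2⟩ := (mem_restrictTarget_source (hB p)).1 hy
    obtain ⟨h1', h2'⟩ := (mem_restrictTarget_source (hB p')).1 hy'
    have hr0 := hr p hp
    obtain ⟨a, c, ha, hac⟩ := exists_affine_on_disc hk (hfx p hp) (hfx p' hp')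
      (show r p / 4 ≤ r p' / 4 by linarith)
      (by rw [hft p hp]; exact Metric.ball_subset_ball (by linarith))
      (by rw [hft p' hp']; exact Metric.ball_subset_ball (by linarith)) h1 h2 h1' h2'
    refine ⟨a, c, ha, fun x hx => ?_⟩
    obtain ⟨h3, h4⟩ := (mem_restrictTarget_source (hB p)).1 hx.1
    exact hac x h3 h4
  refine ⟨E '' {p | ¬ q.IsCritical p}, ?_, ?_, ?_, ?_⟩
  · rintro _ ⟨p, hp, rfl⟩ x hx
    rw [← hD.isCritical_iff, q.not_isCritical_iff hx, hE1 p hp x hx]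
    exact one_ne_zero
  · intro p hp
    rw [← hD.isCritical_iff] at hp
    exact ⟨E p, ⟨p, hp, rfl⟩, (mem_restrictTarget_source (hB p)).2
      ⟨hf p hp, Metric.mem_ball_self (by linarith [hr p hp])⟩⟩
  · rintro _ ⟨p, hp, rfl⟩ z hz
    have h1 := hE1 p hp _ ((E p).1.map_target hz)
    rw [(E p).1.right_inv hz] at h1
    rw [hD.rep_eq (by rw [h1]; exact one_ne_zero),
      KDifferential.logDeriv_eq_zero_of_rep_eq_one (hE1 p hp) hz, zero_div]
  · rintro _ ⟨p, hp, rfl⟩ _ ⟨p', hp', rfl⟩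
    rcases Set.eq_empty_or_nonempty ((E p).1.source ∩ (E p').1.source) with hem | ⟨y, hy, hy'⟩
    · exact ⟨1, one_mem _, 0, by simp [hem]⟩
    -- The affine map goes from the smaller disc to the larger; in the other order it is inverted.
    · rcases le_total (r p) (r p') with hle | hle
      · obtain ⟨a, c, ha, hac⟩ := haff p p' hp hp' hle y hy hy'
        obtain ⟨u, hu, rfl⟩ := hunit a ha
        exact ⟨u, hu, c, hac⟩
      · obtain ⟨a, c, ha, hac⟩ := haff p' p hp' hp hle y hy' hy
        obtain ⟨u, hu, rfl⟩ := hunit a ha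
        refine ⟨u⁻¹, inv_mem hu, -((u⁻¹ : ℂˣ) : ℂ) * c, fun x hx => ?_⟩
        rw [hac x ⟨hx.2, hx.1⟩, mul_add, Units.inv_mul_cancel_left]
        ring

end Monodromy

/-! ### Uniqueness up to a constant -/

section Uniqueness

variable {S : Type*} [TopologicalSpace S] [ChartedSpace ℂ S] [IsManifold 𝓘(ℂ) ω S]
  {k : ℕ} {D : MeromorphicConnection S} {q q' : KDifferential k S}

lemma Adapted.of_eq_const_mul (hD : Adapted D q) {c : ℂ} (hc : c ≠ 0)
    (h : ∀ e z, q'.rep e z = c * q.rep e z) : Adapted D q' := by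
  have h1 : ∀ e, q'.rep e = fun z => c * q.rep e z := fun e => funext (h e)
  have hcrit : ∀ p, q'.IsCritical p ↔ q.IsCritical p := fun p => by
    have hp := mem_chartOf_source p
    rw [← not_iff_not, q'.not_isCritical_iff hp, q.not_isCritical_iff hp, h]
    simp [hc]
  obtain ⟨hpole, hpar⟩ := adapted_iff.1 hD
  refine adapted_iff.2 ⟨fun p => (hpole p).trans (hcrit p).symm, fun e p hp hcp => ?_⟩
  rw [h1, logDeriv_const_mul _ _ hc]
  exact hpar e p hp (mt (hcrit p).2 hcp)

/-- Equal logarithmic derivatives make `q'/q` constant on a punctured disc; normal forms carry the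
proportionality to the centre. -/
lemma Adapted.exists_eventually_eq_const_mul (hk : k ≠ 0) (hq : Adapted D q)
    (hq' : Adapted D q') {e : HolChart S} {p : S} (h : p ∈ e.1.source) :
    ∃ c : ℂ, c ≠ 0 ∧ ∀ᶠ z in 𝓝 (e.1 p), q'.rep e z = c * q.rep e z := by
  have hne : ∀ᶠ z in 𝓝[≠] (e.1 p), q.rep e z ≠ 0 ∧ q'.rep e z ≠ 0 :=
    (KDifferential.eventually_rep_ne_zero h (hq.order_ne_top p)).and
      (KDifferential.eventually_rep_ne_zero h (hq'.order_ne_top p))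
  have hder : ∀ᶠ z in 𝓝[≠] (e.1 p), HasDerivAt (fun w => q'.rep e w / q.rep e w) 0 z := by
    filter_upwards [hne, (eventually_mem_target h).filter_mono nhdsWithin_le_nhds]
      with z ⟨h0, h0'⟩ hz
    have ha := KDifferential.analyticAt_rep (e.1.map_target hz) ((q.not_isCritical_symm_iff hz).2 h0)
    have ha' := KDifferential.analyticAt_rep (e.1.map_target hz) ((q'.not_isCritical_symm_iff hz).2 h0')
    rw [e.1.right_inv hz] at ha ha'
    have heq := (hq.rep_eq h0).symm.trans (hq'.rep_eq h0')
    have hk' : (k : ℂ) ≠ 0 := Nat.cast_ne_zero.2 hk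
    rw [logDeriv_apply, logDeriv_apply] at heq
    field_simp at heq
    refine (ha'.differentiableAt.hasDerivAt.div ha.differentiableAt.hasDerivAt h0).congr_deriv ?_
    rw [div_eq_zero_iff]
    left
    linear_combination -heq
  obtain ⟨c, hc⟩ := exists_eventually_eq_const_of_hasDerivAt_zero hder
  obtain ⟨w, ⟨hw0, hw0'⟩, hw⟩ := (hne.and hc).exists
  have hc0 : c ≠ 0 := hw ▸ div_ne_zero hw0' hw0
  refine ⟨c, hc0, ?_⟩
  have hnf : MeromorphicNFAt ((fun _ => c) * q.rep e) (e.1 p) :=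
    (meromorphicNFAt_mul_iff_right analyticAt_const hc0).2 (q.meromorphic e (e.1.map_source h))
  refine ((q'.meromorphic e (e.1.map_source h)).eventuallyEq_nhdsNE_iff_eventuallyEq_nhds
    hnf).1 ?_
  filter_upwards [hne, hc] with z hz hz'
  rw [Pi.mul_apply, ← hz', div_mul_cancel₀ _ hz.1]

omit [IsManifold 𝓘(ℂ) ω S] in
lemma KDifferential.eventually_eq_const_mul_of_chart {c : ℂ} {e e' : HolChart S} {p : S}
    (h : p ∈ e.1.source) (h' : p ∈ e'.1.source)
    (hc : ∀ᶠ z in 𝓝 (e'.1 p), q'.rep e' z = c * q.rep e' z) :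
    ∀ᶠ z in 𝓝 (e.1 p), q'.rep e z = c * q.rep e z := by
  rw [← transition_apply e' h] at hc
  filter_upwards [q.eventually_rep_eq h h', q'.eventually_rep_eq h h',
    (analyticAt_transition h h').continuousAt.eventually hc] with z h1 h2 h3
  rw [h1, h2, h3]
  ring

lemma Adapted.exists_eq_const_mul [ConnectedSpace S] (hk : k ≠ 0) (hq : Adapted D q)
    (hq' : Adapted D q') :
    ∃ c : ℂ, c ≠ 0 ∧ ∀ (e : HolChart S) (z : ℂ), q'.rep e z = c * q.rep e z := by
  obtain ⟨p₀⟩ : Nonempty S := inferInstance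
  obtain ⟨c, hc0, hc⟩ :=
    hq.exists_eventually_eq_const_mul hk hq' (mem_chartOf_source p₀)
  have hopen : ∀ (c : ℂ) (x : S),
      (∀ᶠ z in 𝓝 ((chartOf x).1 x), q'.rep (chartOf x) z = c * q.rep (chartOf x) z) →
      ∀ᶠ y in 𝓝 x,
        ∀ᶠ z in 𝓝 ((chartOf y).1 y), q'.rep (chartOf y) z = c * q.rep (chartOf y) z := by
    intro c x hx
    have h := mem_chartOf_source x
    refine eventually_nhds_of_chart h ?_
    filter_upwards [hx.eventually_nhds, eventually_mem_target h] with w hw hwt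
    refine KDifferential.eventually_eq_const_mul_of_chart (mem_chartOf_source _)
      ((chartOf x).1.map_target hwt) ?_
    rwa [(chartOf x).1.right_inv hwt]
  have hall := forall_of_eventually_nhds (P := fun x =>
    ∀ᶠ z in 𝓝 ((chartOf x).1 x), q'.rep (chartOf x) z = c * q.rep (chartOf x) z) hc
    -- Near `x` some constant `c' ≠ c` works; a nearby point where `c` also worked would force `c' =
    -- c`, as `q` is not locally zero.
    (hopen c) (fun x hx => by
      obtain ⟨c', -, hc'⟩ := hq.exists_eventually_eq_const_mul hk hq' (mem_chartOf_source x)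
      have hne : c' ≠ c := by
        rintro rfl
        exact hx hc'
      filter_upwards [hopen c' x hc'] with y hy hyc
      obtain ⟨z, ⟨h1, h2⟩, h3⟩ := (((hy.and hyc).filter_mono nhdsWithin_le_nhds).and
        (KDifferential.eventually_rep_ne_zero (mem_chartOf_source y)
          (hq.order_ne_top y))).exists
      exact hne (mul_right_cancel₀ h3 (h1.symm.trans h2)))
  refine ⟨c, hc0, fun e z => ?_⟩
  by_cases hz : z ∈ e.1.target
  · have h := e.1.map_target hz
    have := (KDifferential.eventually_eq_const_mul_of_chart h (mem_chartOf_source _)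
      (hall _)).self_of_nhds
    rwa [e.1.right_inv hz] at this
  · rw [q.rep_eq_zero e z hz, q'.rep_eq_zero e z hz, mul_zero]

end Uniqueness

/-! ### Existence: gluing `dw^k` over a flat atlas -/

section Existence

variable {S : Type*} [TopologicalSpace S] [ChartedSpace ℂ S] [IsManifold 𝓘(ℂ) ω S]

open Classical in
/-- The local representation in the chart `e` of the `k`-differential that equals `dw ^ k` at `p`,
`w` being the coordinate `E p`, and `0` at the poles of the connection. -/
def flatRep (D : MeromorphicConnection S) (k : ℕ) (E : S → HolChart S) (e : HolChart S) (z : ℂ) :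
    ℂ :=
  if z ∈ e.1.target ∧ ¬ D.IsPole (e.1.symm z) then deriv (transition e (E (e.1.symm z))) z ^ k
  else 0

/-- The flat structure given by an atlas `A` of a connection with monodromy in the `k`-th roots of
unity; `E p` is a chart of the atlas around `p`. -/
structure IsFlatAtlas (D : MeromorphicConnection S) (k : ℕ) (A : Set (HolChart S))
    (E : S → HolChart S) : Prop where
  not_isPole : ∀ e ∈ A, ∀ p ∈ e.1.source, ¬ D.IsPole p
  mem : ∀ p, ¬ D.IsPole p → E p ∈ A
  mem_source : ∀ p, ¬ D.IsPole p → p ∈ (E p).1.source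
  rep_eq_zero : ∀ e ∈ A, ∀ z ∈ e.1.target, D.rep e z = 0
  transition_eq : ∀ e ∈ A, ∀ e' ∈ A, ∃ a ∈ rootsOfUnity k ℂ, ∃ c : ℂ,
      ∀ p ∈ e.1.source ∩ e'.1.source, e'.1 p = (a : ℂ) * e.1 p + c

lemma MeromorphicConnection.HasMonodromyIn.exists_isFlatAtlas {D : MeromorphicConnection S}
    {k : ℕ} (h : D.HasMonodromyIn (rootsOfUnity k ℂ)) : ∃ A E, IsFlatAtlas D k A E := by
  obtain ⟨A, h1, h2, h3, h4⟩ := h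
  have hex : ∀ p : S, ∃ e : HolChart S, ¬ D.IsPole p → e ∈ A ∧ p ∈ e.1.source := fun p => by
    by_cases hp : D.IsPole p
    · exact ⟨chartOf p, fun h => (h hp).elim⟩
    · obtain ⟨e, he⟩ := h2 p hp
      exact ⟨e, fun _ => he⟩
  choose E hE using hex
  exact ⟨A, E, h1, fun p hp => (hE p hp).1, fun p hp => (hE p hp).2, h3, h4⟩

namespace IsFlatAtlas

variable {D : MeromorphicConnection S} {k : ℕ} {A : Set (HolChart S)} {E : S → HolChart S}

-- The `k`-th power removes the linear part `a` of the transition. This is where monodromy in the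
-- `k`-th roots of unity makes `dw^k` independent of the flat chart.
omit [IsManifold 𝓘(ℂ) ω S] in
lemma deriv_transition_pow {e f f' : HolChart S} {p : S}
    (hff : ∃ a ∈ rootsOfUnity k ℂ, ∃ c : ℂ,
      ∀ p ∈ f.1.source ∩ f'.1.source, f'.1 p = (a : ℂ) * f.1 p + c)
    (h : p ∈ e.1.source) (hf : p ∈ f.1.source) (hf' : p ∈ f'.1.source) :
    deriv (transition e f') (e.1 p) ^ k = deriv (transition e f) (e.1 p) ^ k := by
  obtain ⟨a, ha, c, hac⟩ := hff
  have h1 : transition f f' =ᶠ[𝓝 (f.1 p)] fun z => (a : ℂ) * z + c := by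
    filter_upwards [eventually_symm_mem_source hf hf'] with z ⟨hz, hz'⟩
    rw [transition, hac _ ⟨f.1.map_target hz, hz'⟩, f.1.right_inv hz]
  have h2 : HasDerivAt (fun z => (a : ℂ) * z + c) (a : ℂ) (f.1 p) :=
    (((hasDerivAt_id _).const_mul (a : ℂ)).add_const c).congr_deriv (mul_one _)
  rw [← deriv_transition_mul f' h hf hf', h1.deriv_eq, h2.deriv, mul_pow,
    (mem_rootsOfUnity' k a).1 ha, one_mul]

lemma flatRep_eq (hA : IsFlatAtlas D k A E) {e f : HolChart S} {p : S} (hf : f ∈ A)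
    (h : p ∈ e.1.source) (hpf : p ∈ f.1.source) :
    flatRep D k E e (e.1 p) = deriv (transition e f) (e.1 p) ^ k := by
  have hp := hA.not_isPole f hf p hpf
  rw [flatRep, e.1.left_inv h, if_pos ⟨e.1.map_source h, hp⟩]
  exact deriv_transition_pow (hA.transition_eq f hf (E p) (hA.mem p hp)) h hpf
    (hA.mem_source p hp)

/-- The chart `E p` in `flatRep` changes with the point; near `p` a single flat chart may replace
it, which gives analyticity. -/
lemma flatRep_eventuallyEq (hA : IsFlatAtlas D k A E) {e f : HolChart S} {p : S} (hf : f ∈ A)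
    (h : p ∈ e.1.source) (hpf : p ∈ f.1.source) :
    flatRep D k E e =ᶠ[𝓝 (e.1 p)] fun z => deriv (transition e f) z ^ k := by
  filter_upwards [eventually_symm_mem_source h hpf] with z ⟨hz, hz'⟩
  have := hA.flatRep_eq hf (e.1.map_target hz) hz'
  rwa [e.1.right_inv hz] at this

lemma flatRep_eq_zero_of_notMem {e : HolChart S} {z : ℂ}
    (h : z ∉ e.1.target) : flatRep D k E e z = 0 := by
  rw [flatRep, if_neg fun h' => h h'.1]

lemma flatRep_eq_zero {e : HolChart S} {p : S} (h : p ∈ e.1.source) (hp : D.IsPole p) :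
    flatRep D k E e (e.1 p) = 0 := by
  rw [flatRep, e.1.left_inv h, if_neg fun h' => h'.2 hp]

lemma flatRep_ne_zero (hA : IsFlatAtlas D k A E) {e : HolChart S} {p : S} (h : p ∈ e.1.source)
    (hp : ¬ D.IsPole p) : flatRep D k E e (e.1 p) ≠ 0 := by
  rw [hA.flatRep_eq (hA.mem p hp) h (hA.mem_source p hp)]
  exact pow_ne_zero k (deriv_transition_ne_zero h (hA.mem_source p hp))

lemma analyticAt_flatRep (hA : IsFlatAtlas D k A E) {e : HolChart S} {p : S}
    (h : p ∈ e.1.source) (hp : ¬ D.IsPole p) : AnalyticAt ℂ (flatRep D k E e) (e.1 p) := by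
  rw [analyticAt_congr (hA.flatRep_eventuallyEq (hA.mem p hp) h (hA.mem_source p hp))]
  exact (analyticAt_transition h (hA.mem_source p hp)).deriv.pow k

lemma logDeriv_flatRep (hA : IsFlatAtlas D k A E) {e : HolChart S} {p : S}
    (h : p ∈ e.1.source) (hp : ¬ D.IsPole p) :
    logDeriv (flatRep D k E e) (e.1 p) = k * D.rep e (e.1 p) := by
  have hE := hA.mem_source p hp
  rw [(logDeriv_congr_nhds (hA.flatRep_eventuallyEq (hA.mem p hp) h hE)).eq_of_nhds,
    logDeriv_fun_pow (analyticAt_transition h hE).deriv.differentiableAt,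
    MeromorphicConnection.rep_eq h hE hp, hA.rep_eq_zero _ (hA.mem p hp) _
    ((E p).1.map_source hE), logDeriv_apply, zero_mul, zero_add]

lemma flatRep_transform (hA : IsFlatAtlas D k A E) {e e' : HolChart S} {p : S}
    (h : p ∈ e.1.source) (h' : p ∈ e'.1.source) :
    flatRep D k E e (e.1 p) =
      deriv (transition e e') (e.1 p) ^ k * flatRep D k E e' (e'.1 p) := by
  by_cases hp : D.IsPole p
  · rw [flatRep_eq_zero h hp, flatRep_eq_zero h' hp, mul_zero]
  · have hE := hA.mem_source p hp
    rw [hA.flatRep_eq (hA.mem p hp) h hE, hA.flatRep_eq (hA.mem p hp) h' hE, ← mul_pow,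
      mul_comm, deriv_transition_mul _ h h' hE]

lemma eventually_flatRep_transform (hA : IsFlatAtlas D k A E) {e e' : HolChart S} {p : S}
    (h : p ∈ e.1.source) (h' : p ∈ e'.1.source) :
    ∀ᶠ z in 𝓝 (e.1 p), flatRep D k E e z =
      deriv (transition e e') z ^ k * flatRep D k E e' (transition e e' z) := by
  filter_upwards [eventually_symm_mem_source h h'] with z ⟨hz, hz'⟩
  have := hA.flatRep_transform (e.1.map_target hz) hz'
  rwa [e.1.right_inv hz] at this

/-- Around the pole the glued function solves `f' = kηf`, and `kη` has a simple pole whose residue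
is an integer `m`; thus `f` is `(z - x)^m` times a unit. -/
lemma meromorphicNFAt_flatRep_chartOf (hA : IsFlatAtlas D k A E) (hk : k ≠ 0)
    (hF : D.IsFuchsian) (hR : D.HasResiduesIn k) {p : S} (hp : D.IsPole p) :
    MeromorphicNFAt (flatRep D k E (chartOf p)) ((chartOf p).1 p) := by
  have hk' : (k : ℂ) ≠ 0 := Nat.cast_ne_zero.2 hk
  have h := mem_chartOf_source p
  set e := chartOf p
  set x := e.1 p
  have hm := (D.meromorphic e (e.1.map_source h)).meromorphicAt
  obtain ⟨g, hg, hg0, hgz⟩ := (meromorphicOrderAt_eq_int_iff (n := -1) hm).1 (hF p hp)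
  replace hgz : ∀ᶠ z in 𝓝[≠] x, D.rep e z = (z - x)⁻¹ * g z :=
    hgz.mono fun z hz => by rw [hz, zpow_neg_one, smul_eq_mul]
  obtain ⟨m, hres⟩ := hR p
  have hgm : g x = m / k := (residue_eq_of_eventually_eq hg hgz).symm.trans hres
  have hm0 : m ≠ 0 := by
    rintro rfl
    rw [hgm] at hg0
    simp at hg0
  obtain ⟨u, hu, hu0, hfu⟩ := eventually_eq_zpow_mul_of_hasDerivAt
    (f := flatRep D k E e) (g := fun z => k * g z) (n := m) (analyticAt_const.mul hg)
    (show (k : ℂ) * g x = m by rw [hgm, mul_div_cancel₀ _ hk']) (by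
      filter_upwards [hgz, D.eventually_not_isPole h,
        (eventually_mem_target h).filter_mono nhdsWithin_le_nhds] with z hz hzp hzt
      have hzs := e.1.map_target hzt
      have h0 := hA.flatRep_ne_zero hzs hzp
      have ha := hA.analyticAt_flatRep hzs hzp
      have hl := hA.logDeriv_flatRep hzs hzp
      rw [e.1.right_inv hzt] at h0 ha hl
      refine ⟨h0, ha.differentiableAt.hasDerivAt.congr_deriv ?_⟩
      rw [logDeriv_apply, div_eq_iff h0, hz] at hl
      rw [hl]
      ring)
  right
  refine ⟨m, u, hu, hu0, ?_⟩
  filter_upwards [eventually_nhdsWithin_iff.1 hfu] with z hz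
  -- The value `0` chosen at poles matches the convention `0 ^ m = 0` for every `m ≠ 0`, negative
  -- ones included.
  by_cases hzx : z = x
  · rw [hzx, flatRep_eq_zero h hp]
    simp [zero_zpow m hm0]
  · exact hz hzx

lemma meromorphicNFOn_flatRep (hA : IsFlatAtlas D k A E) (hk : k ≠ 0)
    (hF : D.IsFuchsian) (hR : D.HasResiduesIn k) (e : HolChart S) :
    MeromorphicNFOn (flatRep D k E e) e.1.target := by
  intro z hz
  have h := e.1.map_target hz
  rw [← e.1.right_inv hz]
  set p := e.1.symm z
  by_cases hp : D.IsPole p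
  · have h' := mem_chartOf_source p
    have ha := analyticAt_transition h h'
    have hd := deriv_transition_ne_zero h h'
    have h1 := hA.meromorphicNFAt_flatRep_chartOf hk hF hR hp
    rw [← transition_apply _ h, ← meromorphicNFAt_comp_iff_of_deriv_ne_zero ha hd,
      ← meromorphicNFAt_mul_iff_right (ha.deriv.pow k) (pow_ne_zero k hd)] at h1
    exact (meromorphicNFAt_congr (hA.eventually_flatRep_transform h h')).2 h1
  · exact (hA.analyticAt_flatRep h hp).meromorphicNFAt

/-- The `k`-differential which is `dw ^ k` in the coordinates `w` of a flat atlas. -/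
def differential (hA : IsFlatAtlas D k A E) (hk : k ≠ 0) (hF : D.IsFuchsian)
    (hR : D.HasResiduesIn k) : KDifferential k S where
  rep := flatRep D k E
  meromorphic := hA.meromorphicNFOn_flatRep hk hF hR
  rep_eq_zero _ _ hz := flatRep_eq_zero_of_notMem hz
  transform _ _ _ h h' := (hA.eventually_flatRep_transform h h').filter_mono nhdsWithin_le_nhds

lemma adapted_differential (hA : IsFlatAtlas D k A E) (hk : k ≠ 0) (hF : D.IsFuchsian)
    (hR : D.HasResiduesIn k) : Adapted D (hA.differential hk hF hR) := by
  have hcrit : ∀ p, D.IsPole p ↔ (hA.differential hk hF hR).IsCritical p := fun p => by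
    have h := mem_chartOf_source p
    rw [← not_iff_not, KDifferential.not_isCritical_iff _ h]
    exact ⟨hA.flatRep_ne_zero h, fun h0 hp => h0 (flatRep_eq_zero h hp)⟩
  refine adapted_iff.2 ⟨hcrit, fun e p h hp => ?_⟩
  have h1 := hA.logDeriv_flatRep h (mt (hcrit p).1 hp)
  have hk' : (k : ℂ) ≠ 0 := Nat.cast_ne_zero.2 hk
  rw [eq_div_iff hk', mul_comm]
  exact h1.symm

end IsFlatAtlas

end Existence

end MeroConn

end

theorem theorem4 {S : Type*} [TopologicalSpace S] [T2Space S] [ConnectedSpace S]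
    [ChartedSpace ℂ S] [IsManifold 𝓘(ℂ) ω S] (k : ℕ) (hk : 0 < k) :
    (∀ D : MeroConn.MeromorphicConnection S,
      D.IsFuchsian → D.HasMonodromyIn (rootsOfUnity k ℂ) → D.HasResiduesIn k →
        ∃ q : MeroConn.KDifferential k S, MeroConn.Adapted D q ∧
          ∀ q' : MeroConn.KDifferential k S, MeroConn.Adapted D q' ↔
            ∃ c : ℂ, c ≠ 0 ∧ ∀ (e : MeroConn.HolChart S) (z : ℂ), q'.rep e z = c * q.rep e z) ∧
    (∀ q : MeroConn.KDifferential k S, q.IsNonzero →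
      (∃! D : MeroConn.MeromorphicConnection S, MeroConn.Adapted D q) ∧
      ∀ D : MeroConn.MeromorphicConnection S, MeroConn.Adapted D q →
        D.IsFuchsian ∧ D.HasMonodromyIn (rootsOfUnity k ℂ) ∧ D.HasResiduesIn k) := by
  refine ⟨fun D hF hM hR => ?_, fun q hq => ⟨⟨q.connection hk.ne' hq.order_ne_top,
    MeroConn.KDifferential.adapted_connection hk.ne' hq.order_ne_top,
    fun D hD => hD.connection_unique
      (MeroConn.KDifferential.adapted_connection hk.ne' hq.order_ne_top)⟩,
    fun D hD => ⟨hD.isFuchsian hk.ne', hD.hasMonodromyIn hk.ne', hD.hasResiduesIn⟩⟩⟩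
  obtain ⟨A, E, hA⟩ := hM.exists_isFlatAtlas
  have hD := hA.adapted_differential hk.ne' hF hR
  exact ⟨_, hD, fun q' => ⟨fun hD' => hD.exists_eq_const_mul hk.ne' hD',
    fun ⟨c, hc, h⟩ => hD.of_eq_const_mul hc h⟩⟩
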